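/- Let $t\in\mathbb R$, $B>0$, $q\in[1,2)$, $p\ge 4q$ with $p>4$, and $\varepsilon\in(0,1)$. There is a constant $C=C(t,B,q,p,\varepsilon)>0$, depending only on these parameters, such that the following holds. Let $(\Omega,\mu)$ be a probability space and let $X_N$ be a linear space of (real- or complex-valued) functions on $\Omega$, contained in $L_q(\Omega,\mu)$ and spanned by $N$ functions. Here a function is a specific function on $\Omega$, not an equivalence class. Assume that for every $f\in X_N$ $$\|f\|_\infty\le t\,N^{1/2}\,\|f\|_2\qquad\text{and}\qquad \|f\|_p\le B\,\|f\|_q ,$$ where the norms are those of $L_r(\Omega,\mu)$ ($\|\cdot\|_\infty$ is the essential supremum). Then for every natural number $m\ge CN$ there are points $\xi^1,\dots,\xi^m\in\Omega$ (not necessarily distinct) such that for every $f\in X_N$ $$(1-\varepsilon)\|f\|_q^q\;\le\;\frac1m\sum_{j=1}^m|f(\xi^j)|^q\;\le\;(1+\varepsilon)\|f\|_q^q .$$ -/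

import Mathlib

open MeasureTheory
open scoped ENNReal

/-- `X` is a subspace of `L_q(Ω, μ)` of dimension at most `N`: its elements are honest functions on
`Ω` whose `q`-th power is integrable, and it is the linear span of `N` functions. -/
structure IsSubspaceOfLq {Ω 𝕜 : Type*} [MeasurableSpace Ω] [RCLike 𝕜] (μ : Measure Ω) (q : ℝ)
    (N : ℕ) (X : Submodule 𝕜 (Ω → 𝕜)) : Prop where
  memLp : ∀ f ∈ X, MemLp f (ENNReal.ofReal q) μ
  exists_span : ∃ u : Fin N → Ω → 𝕜, X = Submodule.span 𝕜 (Set.range u)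

/-- The Nikol'skii inequality `‖f‖_∞ ≤ t N^{1/2} ‖f‖_2` for all `f ∈ X`
(with the essential supremum norm). -/
def NikolskiiTwoInfty {Ω 𝕜 : Type*} [MeasurableSpace Ω] [RCLike 𝕜] (μ : Measure Ω) (t : ℝ)
    (N : ℕ) (X : Submodule 𝕜 (Ω → 𝕜)) : Prop :=
  ∀ f ∈ X, eLpNorm f ∞ μ ≤ ENNReal.ofReal (t * Real.sqrt N) * eLpNorm f 2 μ

/-- The moment inequality `‖f‖_p ≤ B ‖f‖_q` for all `f ∈ X`. -/
def MomentComparison {Ω 𝕜 : Type*} [MeasurableSpace Ω] [RCLike 𝕜] (μ : Measure Ω) (p q B : ℝ)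
    (X : Submodule 𝕜 (Ω → 𝕜)) : Prop :=
  ∀ f ∈ X, eLpNorm f (ENNReal.ofReal p) μ ≤
    ENNReal.ofReal B * eLpNorm f (ENNReal.ofReal q) μ

/-- The Marcinkiewicz discretization theorem with equal weights: there are `m` points `ξ j` of `Ω`
(repetitions allowed) such that
`C₁ ‖f‖_q^q ≤ (1/m) ∑ j, |f (ξ j)|^q ≤ C₂ ‖f‖_q^q` for all `f ∈ X`. -/
def Marcinkiewicz {Ω 𝕜 : Type*} [MeasurableSpace Ω] [RCLike 𝕜] (μ : Measure Ω)
    (X : Submodule 𝕜 (Ω → 𝕜)) (m : ℕ) (q C₁ C₂ : ℝ) : Prop :=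
  ∃ ξ : Fin m → Ω, ∀ f ∈ X,
    C₁ * ∫ x, ‖f x‖ ^ q ∂μ ≤ 1 / (m : ℝ) * ∑ j, ‖f (ξ j)‖ ^ q ∧
    1 / (m : ℝ) * ∑ j, ‖f (ξ j)‖ ^ q ≤ C₂ * ∫ x, ‖f x‖ ^ q ∂μ

/-- The Marcinkiewicz discretization theorem with constants `1 - ε` and `1 + ε`. -/
def MarcinkiewiczEps {Ω 𝕜 : Type*} [MeasurableSpace Ω] [RCLike 𝕜] (μ : Measure Ω)
    (X : Submodule 𝕜 (Ω → 𝕜)) (m : ℕ) (q ε : ℝ) : Prop :=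
  Marcinkiewicz μ X m q (1 - ε) (1 + ε)

/-! In Euclidean coordinates each `f` in the space is a.e. `x ↦ ⟪v x, c⟫` with `‖f‖_2 = ‖c‖`, and
the Nikol'skii inequality says that `‖v x‖ ≤ |t| √N` a.e. For independent random points `ξ^j`, the
averages of `|⟪v (ξ^j), c⟫|^q` must approximate the integral uniformly over unit vectors `c`. By the
moment comparison `‖f‖_q ≥ ‖f‖_2 / B`, so an absolute error on the sphere is a relative one.

Powers truncated at a level `l` are bounded and Lipschitz. For them Hoeffding's inequality on a
`δ`-net of `exp(O(N))` points suffices once `m ≥ CN`. The difficulty is the contribution of values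
above `l`, which must be small uniformly in `c`. It is, if the coefficients obey a weak `ℓ_r` bound:
at most `K m s^(-r)` of them exceed `s`, where `q < r ≤ 2`. By duality this follows from `‖∑_{j ∈ J}
v (ξ^j)‖ ≤ M |J|^α m^(1-α)` with `α = 1 - 1/r`, which is `SparselyCorrelated.norm_sum_le`.

To bound such a sum, its square is decoupled into a diagonal part and an inner product of sums over
disjoint sets `I`, `J`. Given the sum over `I`, the points indexed by `J` are still independent. By
Markov's inequality for `p`-th moments, all `k = |J|` of them correlate strongly with that sum with
probability at most `((k/m)^3 / 30)^k`. The cube pays for the choice of `J` and of `I` with `|I| ≤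
2k`; this is where `3r ≤ p` enters (`measure_not_sparselyCorrelated_le`). Outside the exceptional
event fewer than half of the vectors are strongly correlated. Keeping only these, alternately in `J`
and in `I`, gives a geometric recursion. It bounds the optimal `M` in terms of itself, `M² ≤ T² +
4cM`, hence independently of `m` and `N`. -/

/-- The gauge `k ^ α * m ^ (1 - α)`, which measures sums of `k` out of `m` vectors. -/
noncomputable def sparseGauge (α : ℝ) (m k : ℕ) : ℝ := (k : ℝ) ^ α * (m : ℝ) ^ (1 - α)

/-! ### Elementary estimates for the gauge. -/

section SparseGauge

variable {α : ℝ} {m k l : ℕ}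

theorem sparseGauge_nonneg : 0 ≤ sparseGauge α m k := by
  unfold sparseGauge; positivity

theorem sparseGauge_pos (hm : 0 < m) (hk : 0 < k) : 0 < sparseGauge α m k := by
  unfold sparseGauge
  have : (0 : ℝ) < m := by exact_mod_cast hm
  have : (0 : ℝ) < k := by exact_mod_cast hk
  positivity

theorem sparseGauge_mono (hα : 0 ≤ α) (h : k ≤ l) : sparseGauge α m k ≤ sparseGauge α m l := by
  unfold sparseGauge
  gcongr

/-- The factor `4 ^ (-α) < 1` (for `α > 0`) makes the halving recursion geometric. -/
theorem sparseGauge_sq_le_of_two_mul_le (hα : 0 ≤ α) (h : 2 * k ≤ l) :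
    sparseGauge α m k ^ 2 ≤ (4 : ℝ) ^ (-α) * sparseGauge α m l ^ 2 := by
  have h2 : (2 : ℝ) ^ α * (k : ℝ) ^ α ≤ (l : ℝ) ^ α := by
    rw [← Real.mul_rpow (by norm_num) (by positivity)]
    have : (2 : ℝ) * k ≤ l := by exact_mod_cast h
    gcongr
  have h4 : (4 : ℝ) ^ (-α) * ((2 : ℝ) ^ α) ^ 2 = 1 := by
    have : (4 : ℝ) ^ α = ((2 : ℝ) ^ α) ^ 2 := by
      rw [show (4 : ℝ) = 2 * 2 by norm_num, Real.mul_rpow (by norm_num) (by norm_num), sq]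
    rw [Real.rpow_neg (by norm_num), this]
    exact inv_mul_cancel₀ (by positivity)
  calc sparseGauge α m k ^ 2 =
      (4 : ℝ) ^ (-α) * ((2 : ℝ) ^ α * (k : ℝ) ^ α * (m : ℝ) ^ (1 - α)) ^ 2 := by
        unfold sparseGauge
        linear_combination (-1 : ℝ) * ((k : ℝ) ^ α * (m : ℝ) ^ (1 - α)) ^ 2 * h4
    _ ≤ _ := by unfold sparseGauge; gcongr

/-- Absorbs the diagonal terms `∑ ‖w j‖²`. The quotient of the two sides is `(m/k)^(1 - 2α) ≥ 1`;
this is the reason for `r ≤ 2`. -/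
theorem mul_le_sparseGauge_sq (hα : α ≤ 1 / 2) (h : k ≤ m) :
    (k : ℝ) * m ≤ sparseGauge α m k ^ 2 := by
  rcases Nat.eq_zero_or_pos k with rfl | hk
  · simpa using sq_nonneg _
  have hk' : (0 : ℝ) < k := by exact_mod_cast hk
  have hm' : (0 : ℝ) < m := by exact_mod_cast hk.trans_le h
  have hkm : (k : ℝ) ≤ m := by exact_mod_cast h
  unfold sparseGauge
  have e : ((k : ℝ) ^ α * (m : ℝ) ^ (1 - α)) ^ 2 =
      k * m * ((m : ℝ) ^ (1 - 2 * α) * (k : ℝ) ^ (-(1 - 2 * α))) := by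
    rw [mul_pow, ← Real.rpow_natCast, ← Real.rpow_natCast, ← Real.rpow_mul hk'.le,
      ← Real.rpow_mul hm'.le]
    have e1 : (k : ℝ) ^ (α * ((2 : ℕ) : ℝ)) = k * (k : ℝ) ^ (-(1 - 2 * α)) := by
      nth_rewrite 2 [← Real.rpow_one (k : ℝ)]
      rw [← Real.rpow_add hk']; congr 1; push_cast; ring
    have e2 : (m : ℝ) ^ ((1 - α) * ((2 : ℕ) : ℝ)) = m * (m : ℝ) ^ (1 - 2 * α) := by
      nth_rewrite 2 [← Real.rpow_one (m : ℝ)]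
      rw [← Real.rpow_add hm']; congr 1; push_cast; ring
    rw [e1, e2]; ring
  rw [e]
  refine le_mul_of_one_le_right (by positivity) ?_
  rw [Real.rpow_neg hk'.le, ← div_eq_mul_inv, one_le_div (by positivity)]
  exact Real.rpow_le_rpow hk'.le hkm (by linarith)

end SparseGauge

/-! ### Deterministic bounds for sums of sparsely correlated vectors. -/

section Combinatorial

variable {𝕜 E ι : Type*} [RCLike 𝕜] [NormedAddCommGroup E] [InnerProductSpace 𝕜 E]

/-- Greedy decoupling: each new vector joins the side whose opposite sum has the larger real inner
product with it, so its two cross terms `2x + 2y` are at most `4 max x y`. -/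
theorem exists_split_norm_sum_sq_le [DecidableEq ι] (w : ι → E) (J : Finset ι) :
    ∃ S S' : Finset ι, Disjoint S S' ∧ S ∪ S' = J ∧
      ‖∑ j ∈ J, w j‖ ^ 2 ≤ ∑ j ∈ J, ‖w j‖ ^ 2 +
        4 * RCLike.re (inner 𝕜 (∑ i ∈ S, w i) (∑ j ∈ S', w j)) := by
  induction J using Finset.induction_on with
  | empty => exact ⟨∅, ∅, by simp⟩
  | insert a J ha ih =>
    obtain ⟨S, S', hd, hu, hle⟩ := ih
    have haS : a ∉ S := fun h => ha (hu ▸ Finset.mem_union_left _ h)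
    have haS' : a ∉ S' := fun h => ha (hu ▸ Finset.mem_union_right _ h)
    have hsum : ∑ j ∈ J, w j = ∑ j ∈ S, w j + ∑ j ∈ S', w j := by
      rw [← hu, Finset.sum_union hd]
    have key : ‖∑ j ∈ insert a J, w j‖ ^ 2 = ‖w a‖ ^ 2 + ‖∑ j ∈ J, w j‖ ^ 2 +
        2 * RCLike.re (inner 𝕜 (∑ i ∈ S, w i) (w a)) +
        2 * RCLike.re (inner 𝕜 (w a) (∑ j ∈ S', w j)) := by
      rw [Finset.sum_insert ha, norm_add_sq (𝕜 := 𝕜), hsum, inner_add_right, map_add,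
        inner_re_symm (w a) (∑ i ∈ S, w i)]
      ring
    rcases le_total (RCLike.re (inner 𝕜 (∑ i ∈ S, w i) (w a)))
      (RCLike.re (inner 𝕜 (w a) (∑ j ∈ S', w j))) with h | h
    · refine ⟨insert a S, S', ?_, ?_, ?_⟩
      · rw [Finset.disjoint_insert_left]; exact ⟨haS', hd⟩
      · rw [Finset.insert_union, hu]
      · rw [key, Finset.sum_insert ha, Finset.sum_insert haS, inner_add_left, map_add]
        linarith
    · refine ⟨S, insert a S', ?_, ?_, ?_⟩
      · rw [Finset.disjoint_insert_right]; exact ⟨haS, hd⟩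
      · rw [Finset.union_insert, hu]
      · rw [key, Finset.sum_insert ha, Finset.sum_insert haS', inner_add_right, map_add]
        linarith

variable (𝕜) in
/-- Correlation bound: every sum `∑ i ∈ I, w i` is almost orthogonal to some vector of each
disjoint family which is at least half as large. -/
def SparselyCorrelated (w : ι → E) (α S : ℝ) (m : ℕ) : Prop :=
  ∀ I J : Finset ι, Disjoint I J → J.Nonempty → I.card ≤ 2 * J.card →
    ∃ j ∈ J, ‖inner 𝕜 (w j) (∑ i ∈ I, w i)‖ * J.card ≤
      S * sparseGauge α m J.card * ‖∑ i ∈ I, w i‖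

variable {w : ι → E} {α S M : ℝ} {m : ℕ}

/-- Discarding fewer than half of the vectors of `J`, those most correlated with `∑ i ∈ I, w i`. -/
theorem SparselyCorrelated.exists_subset (h : SparselyCorrelated 𝕜 w α S m) (hα : 0 ≤ α)
    (hS : 0 ≤ S) (hM : ∀ J : Finset ι, ‖∑ j ∈ J, w j‖ ≤ M * sparseGauge α m J.card)
    (hM0 : 0 ≤ M) {k : ℕ} (hk : 0 < k) {I J : Finset ι} (hd : Disjoint I J)
    (hI : I.card ≤ k) (hJ : J.card ≤ k) :
    ∃ J' ⊆ J, 2 * J'.card < k ∧ ‖inner 𝕜 (∑ j ∈ J, w j) (∑ i ∈ I, w i)‖ ≤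
      ‖inner 𝕜 (∑ j ∈ J', w j) (∑ i ∈ I, w i)‖ + 2 * S * M * sparseGauge α m k ^ 2 := by
  classical
  set F := ∑ i ∈ I, w i with hF
  have hk' : (0 : ℝ) < k := by exact_mod_cast hk
  -- At this threshold, `k` uncorrelated vectors contribute at most `2SMφ(k)²`, where `φ` is the
  -- gauge, while `k/2` or more vectors above it would contradict the correlation bound.
  set τ := 2 * S * M * sparseGauge α m k ^ 2 / k with hτ
  have hτ0 : 0 ≤ τ := by rw [hτ]; positivity
  set J' := J.filter fun j => τ < ‖inner 𝕜 (w j) F‖ with hJ'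
  have hsub : J' ⊆ J := Finset.filter_subset _ _
  refine ⟨J', hsub, ?_, ?_⟩
  · by_contra! hcon
    have hne : J'.Nonempty := by
      rw [← Finset.card_pos]; omega
    obtain ⟨j, hj, hle⟩ := h I J' (hd.mono_right hsub) hne (by omega)
    have hjτ : τ < ‖inner 𝕜 (w j) F‖ := (Finset.mem_filter.1 hj).2
    have hcard : (k : ℝ) ≤ 2 * J'.card := by exact_mod_cast hcon
    have h1 : S * sparseGauge α m J'.card * ‖F‖ ≤
        S * sparseGauge α m k * (M * sparseGauge α m k) := by
      have a1 : sparseGauge α m J'.card ≤ sparseGauge α m k :=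
        sparseGauge_mono hα ((Finset.card_le_card hsub).trans hJ)
      have a2 : ‖F‖ ≤ M * sparseGauge α m k :=
        (hM I).trans (mul_le_mul_of_nonneg_left (sparseGauge_mono hα hI) hM0)
      have := sparseGauge_nonneg (α := α) (m := m) (k := k)
      gcongr
    have h2 : τ * k < ‖inner 𝕜 (w j) F‖ * (2 * J'.card) := by
      calc τ * k < ‖inner 𝕜 (w j) F‖ * k := by gcongr
        _ ≤ _ := by gcongr
    have h3 : τ * k = 2 * S * M * sparseGauge α m k ^ 2 := by
      rw [hτ]; field_simp
    nlinarith
  · rw [← Finset.sum_filter_add_sum_filter_not J (fun j => τ < ‖inner 𝕜 (w j) F‖), inner_add_left]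
    refine (norm_add_le _ _).trans (add_le_add le_rfl ?_)
    rw [sum_inner]
    refine (norm_sum_le _ _).trans ?_
    refine (Finset.sum_le_card_nsmul _ _ τ fun j hj => ?_).trans ?_
    · simpa using (Finset.mem_filter.1 hj).2
    · rw [nsmul_eq_mul]
      have : ((J.filter fun j => ¬ τ < ‖inner 𝕜 (w j) F‖).card : ℝ) ≤ k := by
        exact_mod_cast (Finset.card_le_card (Finset.filter_subset _ _)).trans hJ
      calc _ ≤ (k : ℝ) * τ := by gcongr
        _ = _ := by rw [hτ]; field_simp

/-- Thinning `J` and then `I` costs `2SMφ(k)²` each and leaves sets of less than half the size. The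
total is a geometric series of ratio `4 ^ (-α)`. -/
theorem SparselyCorrelated.norm_inner_sum_le (h : SparselyCorrelated 𝕜 w α S m) (hα : 0 < α)
    (hS : 0 ≤ S) (hM : ∀ J : Finset ι, ‖∑ j ∈ J, w j‖ ≤ M * sparseGauge α m J.card)
    (hM0 : 0 ≤ M) (k : ℕ) : ∀ I J : Finset ι, Disjoint I J → I.card ≤ k → J.card ≤ k →
      ‖inner 𝕜 (∑ j ∈ J, w j) (∑ i ∈ I, w i)‖ ≤
        4 * S / (1 - 4 ^ (-α)) * M * sparseGauge α m k ^ 2 := by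
  have hρ : (4 : ℝ) ^ (-α) < 1 := Real.rpow_lt_one_of_one_lt_of_neg (by norm_num) (by linarith)
  set c := 4 * S / (1 - (4 : ℝ) ^ (-α)) with hc
  have hc0 : 0 ≤ c := div_nonneg (by positivity) (by linarith)
  have hceq : c * 4 ^ (-α) + 4 * S = c := by
    have : (1 - (4 : ℝ) ^ (-α)) ≠ 0 := by linarith
    rw [hc]; field_simp; ring
  induction k using Nat.strong_induction_on with
  | _ k ih =>
    intro I J hd hI hJ
    rcases Nat.eq_zero_or_pos k with rfl | hk
    · rw [Nat.le_zero, Finset.card_eq_zero] at hI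
      subst hI
      simp only [Finset.sum_empty, inner_zero_right, norm_zero]
      positivity
    obtain ⟨J', hJ', hcJ, hleJ⟩ := h.exists_subset hα.le hS hM hM0 hk hd hI hJ
    have hd' := hd.mono_right hJ'
    obtain ⟨I', hI', hcI, hleI⟩ := h.exists_subset hα.le hS hM hM0 hk hd'.symm
      ((Finset.card_le_card hJ').trans hJ) hI
    -- `2 * card < k` means `card ≤ (k - 1) / 2`, which is below `k` also when `k = 1`.
    have h1 := ih ((k - 1) / 2) (by omega) I' J' (hd'.mono_left hI') (by omega) (by omega)
    rw [norm_inner_symm] at hleI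
    rw [norm_inner_symm (∑ j ∈ I', w j)] at hleI
    have h2 : sparseGauge α m ((k - 1) / 2) ^ 2 ≤ (4 : ℝ) ^ (-α) * sparseGauge α m k ^ 2 :=
      sparseGauge_sq_le_of_two_mul_le hα.le (by omega)
    calc _ ≤ c * M * sparseGauge α m ((k - 1) / 2) ^ 2 + 4 * S * M * sparseGauge α m k ^ 2 := by
          linarith
      _ ≤ c * M * ((4 : ℝ) ^ (-α) * sparseGauge α m k ^ 2) + 4 * S * M * sparseGauge α m k ^ 2 := by
          gcongr
      _ = (c * 4 ^ (-α) + 4 * S) * M * sparseGauge α m k ^ 2 := by ring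
      _ = _ := by rw [hceq]

/-- Sums of few vectors of a sparsely correlated family are short. -/
theorem SparselyCorrelated.norm_sum_le [Fintype ι] (h : SparselyCorrelated 𝕜 w α S m)
    (hα : 0 < α) (hα2 : α ≤ 1 / 2) (hS : 0 ≤ S) {T : ℝ} (hT : 0 ≤ T)
    (hcard : Fintype.card ι = m) (hw : ∀ j, ‖w j‖ ^ 2 ≤ T ^ 2 * m) (J : Finset ι) :
    ‖∑ j ∈ J, w j‖ ≤ (T + 16 * S / (1 - 4 ^ (-α))) * sparseGauge α m J.card := by
  classical
  have hρ : (4 : ℝ) ^ (-α) < 1 := Real.rpow_lt_one_of_one_lt_of_neg (by norm_num) (by linarith)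
  set c := 4 * S / (1 - (4 : ℝ) ^ (-α)) with hc
  have hc0 : 0 ≤ c := div_nonneg (by positivity) (by linarith)
  have hc4 : 16 * S / (1 - (4 : ℝ) ^ (-α)) = 4 * c := by rw [hc]; ring
  rw [hc4]
  -- `M` is the optimal constant, attained at `J₀`. Applying the decoupled estimate at `J₀` bounds
  -- `M²` by an expression linear in `M`.
  obtain ⟨J₀, -, hJ₀⟩ := Finset.exists_max_image (Finset.univ : Finset (Finset ι))
    (fun J => ‖∑ j ∈ J, w j‖ / sparseGauge α m J.card) ⟨∅, Finset.mem_univ _⟩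
  set M := ‖∑ j ∈ J₀, w j‖ / sparseGauge α m J₀.card with hMdef
  have hM0 : 0 ≤ M := div_nonneg (norm_nonneg _) sparseGauge_nonneg
  have hcardle : ∀ J : Finset ι, J.card ≤ m := fun J => hcard ▸ Finset.card_le_univ J
  have hpos : ∀ J : Finset ι, J.Nonempty → 0 < sparseGauge α m J.card := fun J hJ =>
    sparseGauge_pos (hJ.card_pos.trans_le (hcardle J)) hJ.card_pos
  have hM : ∀ J : Finset ι, ‖∑ j ∈ J, w j‖ ≤ M * sparseGauge α m J.card := by
    intro J
    rcases J.eq_empty_or_nonempty with rfl | hJ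
    · simpa using mul_nonneg hM0 sparseGauge_nonneg
    · exact (div_le_iff₀ (hpos J hJ)).1 (hJ₀ J (Finset.mem_univ _))
  suffices hMle : M ≤ T + 4 * c from
    (hM J).trans (mul_le_mul_of_nonneg_right hMle sparseGauge_nonneg)
  rcases J₀.eq_empty_or_nonempty with h0 | hne
  · have : M = 0 := by rw [hMdef, h0]; simp
    rw [this]; positivity
  have hφ := hpos J₀ hne
  set φ := sparseGauge α m J₀.card with hφdef
  obtain ⟨A, A', hd, hu, hle⟩ := exists_split_norm_sum_sq_le (𝕜 := 𝕜) w J₀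
  have hA : A.card ≤ J₀.card := Finset.card_le_card (hu ▸ Finset.subset_union_left)
  have hA' : A'.card ≤ J₀.card := Finset.card_le_card (hu ▸ Finset.subset_union_right)
  have h1 := h.norm_inner_sum_le hα hS hM hM0 J₀.card A' A hd.symm hA' hA
  have h2 : ∑ j ∈ J₀, ‖w j‖ ^ 2 ≤ T ^ 2 * φ ^ 2 := by
    calc ∑ j ∈ J₀, ‖w j‖ ^ 2 ≤ J₀.card • (T ^ 2 * m) := Finset.sum_le_card_nsmul _ _ _ fun j _ => hw j
      _ = T ^ 2 * (J₀.card * m) := by rw [nsmul_eq_mul]; ring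
      _ ≤ _ := by gcongr; exact mul_le_sparseGauge_sq hα2 (hcardle J₀)
  have h3 : ‖∑ j ∈ J₀, w j‖ = M * φ := by rw [hMdef]; field_simp
  have h4 := (RCLike.re_le_norm (inner 𝕜 (∑ i ∈ A, w i) (∑ j ∈ A', w j))).trans h1
  rw [h3] at hle
  have h5 : M ^ 2 * φ ^ 2 ≤ (T ^ 2 + 4 * c * M) * φ ^ 2 := by
    calc M ^ 2 * φ ^ 2 = (M * φ) ^ 2 := by ring
      _ ≤ T ^ 2 * φ ^ 2 + 4 * (c * M * φ ^ 2) := by linarith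
      _ = _ := by ring
  have h6 : M ^ 2 ≤ T ^ 2 + 4 * c * M := le_of_mul_le_mul_right h5 (by positivity)
  by_contra! hcon
  nlinarith

end Combinatorial

/-! ### From short sums to weak `ℓ_r` bounds and tails. -/

section WeakType

variable {𝕜 E ι : Type*} [RCLike 𝕜] [NormedAddCommGroup E] [InnerProductSpace 𝕜 E]

theorem natCast_le_of_mul_le_sparseGauge {α A s r : ℝ} {m k : ℕ} (hα : α < 1)
    (hr : r * (1 - α) = 1) (hA : 0 ≤ A) (hs : 0 < s)
    (h : k * s ≤ A * sparseGauge α m k) : (k : ℝ) ≤ m * (A / s) ^ r := by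
  have hr0 : 0 < r := by
    by_contra! h0
    nlinarith
  rcases Nat.eq_zero_or_pos k with rfl | hk
  · simp only [Nat.cast_zero]; positivity
  have hk' : (0 : ℝ) < k := by exact_mod_cast hk
  have h1 : (k : ℝ) ^ (1 - α) ≤ (A / s) * (m : ℝ) ^ (1 - α) := by
    have e : (k : ℝ) = k ^ α * k ^ (1 - α) := by rw [← Real.rpow_add hk']; simp
    have h2 : (k : ℝ) ^ α * ((k : ℝ) ^ (1 - α) * s) ≤ (k : ℝ) ^ α * (A * (m : ℝ) ^ (1 - α)) := by
      unfold sparseGauge at h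
      calc _ = (k : ℝ) ^ α * (k : ℝ) ^ (1 - α) * s := by ring
        _ = k * s := by rw [← e]
        _ ≤ _ := h
        _ = _ := by ring
    have h3 := le_of_mul_le_mul_left h2 (by positivity)
    rw [div_mul_eq_mul_div, le_div_iff₀ hs]
    exact h3
  have h4 := Real.rpow_le_rpow (by positivity) h1 hr0.le
  rw [← Real.rpow_mul hk'.le, Real.mul_rpow (by positivity) (by positivity),
    ← Real.rpow_mul (by positivity), show (1 - α) * r = 1 by linarith, Real.rpow_one,
    Real.rpow_one, mul_comm] at h4
  exact h4

variable {w : ι → E} {α r M : ℝ} {m : ℕ}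

/-- Duality: the terms selected by `L` are all positive, so their sum cannot cancel and is
controlled by the norm of the corresponding sum of vectors. -/
theorem card_filter_lt_re_le [Fintype ι] (hα : α < 1) (hr : r * (1 - α) = 1)
    (hM0 : 0 ≤ M) (hM : ∀ J : Finset ι, ‖∑ j ∈ J, w j‖ ≤ M * sparseGauge α m J.card)
    (L : 𝕜 →+ ℝ) (hL : ∀ z, L z ≤ ‖z‖) (c : E) {s : ℝ} (hs : 0 < s) :
    ((Finset.univ.filter fun j => s < L (inner 𝕜 (w j) c)).card : ℝ) ≤ m * (M * ‖c‖ / s) ^ r := by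
  set J := Finset.univ.filter fun j => s < L (inner 𝕜 (w j) c) with hJ
  refine natCast_le_of_mul_le_sparseGauge hα hr (by positivity) hs ?_
  calc (J.card : ℝ) * s = J.card • s := by rw [nsmul_eq_mul]
    _ ≤ ∑ j ∈ J, L (inner 𝕜 (w j) c) :=
      Finset.card_nsmul_le_sum _ _ _ fun j hj => (Finset.mem_filter.1 hj).2.le
    _ = L (inner 𝕜 (∑ j ∈ J, w j) c) := by rw [sum_inner, map_sum]
    _ ≤ ‖inner 𝕜 (∑ j ∈ J, w j) c‖ := hL _
    _ ≤ ‖∑ j ∈ J, w j‖ * ‖c‖ := norm_inner_le_norm _ _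
    _ ≤ M * sparseGauge α m J.card * ‖c‖ := by gcongr; exact hM J
    _ = _ := by ring

/-- If sums of few vectors `w j` are short, then the coefficients `⟪w j, c⟫` are bounded in
weak `ℓ_r`. -/
theorem card_filter_lt_norm_inner_le [Fintype ι] (hα : α < 1) (hr : r * (1 - α) = 1)
    (hM0 : 0 ≤ M) (hM : ∀ J : Finset ι, ‖∑ j ∈ J, w j‖ ≤ M * sparseGauge α m J.card)
    (c : E) {s : ℝ} (hs : 0 < s) :
    ((Finset.univ.filter fun j => s < ‖inner 𝕜 (w j) c‖).card : ℝ) ≤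
      4 * (2 * M * ‖c‖) ^ r * m * s ^ (-r) := by
  classical
  let re : 𝕜 →+ ℝ := RCLike.re
  let im : 𝕜 →+ ℝ := RCLike.im
  have hs2 : 0 < s / 2 := by positivity
  -- A scalar of modulus above `s` has one of `±re`, `±im` above `s / 2`. This gives the factors `4`
  -- and `2` of the conclusion.
  have key := fun (L : 𝕜 →+ ℝ) (hL : ∀ z, L z ≤ ‖z‖) =>
    card_filter_lt_re_le hα hr hM0 hM L hL c hs2
  have b1 := key re RCLike.re_le_norm
  have b2 := key (-re) fun z => (neg_le_abs _).trans (RCLike.abs_re_le_norm z)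
  have b3 := key im RCLike.im_le_norm
  have b4 := key (-im) fun z => (neg_le_abs _).trans (RCLike.abs_im_le_norm z)
  have hsub : (Finset.univ.filter fun j => s < ‖inner 𝕜 (w j) c‖) ⊆
      ((Finset.univ.filter fun j => s / 2 < re (inner 𝕜 (w j) c)) ∪
        (Finset.univ.filter fun j => s / 2 < (-re) (inner 𝕜 (w j) c))) ∪
      ((Finset.univ.filter fun j => s / 2 < im (inner 𝕜 (w j) c)) ∪
        (Finset.univ.filter fun j => s / 2 < (-im) (inner 𝕜 (w j) c))) := by
    intro j hj
    simp only [Finset.mem_filter, Finset.mem_univ, true_and, Finset.mem_union] at hj ⊢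
    change (s / 2 < re (inner 𝕜 (w j) c) ∨ s / 2 < -re (inner 𝕜 (w j) c)) ∨
      (s / 2 < im (inner 𝕜 (w j) c) ∨ s / 2 < -im (inner 𝕜 (w j) c))
    rw [← lt_abs, ← lt_abs]
    by_contra! hcon
    have := norm_add_le (RCLike.re (inner 𝕜 (w j) c) : 𝕜) (RCLike.im (inner 𝕜 (w j) c) * RCLike.I)
    rw [RCLike.re_add_im, norm_mul, RCLike.norm_ofReal, RCLike.norm_ofReal] at this
    replace this := this.trans (add_le_add le_rfl
      (mul_le_of_le_one_right (abs_nonneg _)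
        (by rw [RCLike.norm_I]; split_ifs <;> norm_num)))
    have h1 : |re (inner 𝕜 (w j) c)| ≤ s / 2 := hcon.1
    have h2 : |im (inner 𝕜 (w j) c)| ≤ s / 2 := hcon.2
    change _ ≤ |re (inner 𝕜 (w j) c)| + |im (inner 𝕜 (w j) c)| at this
    linarith
  have hc := (Finset.card_le_card hsub).trans ((Finset.card_union_le _ _).trans
    (add_le_add (Finset.card_union_le _ _) (Finset.card_union_le _ _)))
  rw [← Nat.cast_le (α := ℝ)] at hc
  push_cast at hc
  have e : (M * ‖c‖ / (s / 2)) ^ r = (2 * M * ‖c‖) ^ r * s ^ (-r) := by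
    rw [Real.rpow_neg hs.le, ← div_eq_mul_inv, ← Real.div_rpow (by positivity) hs.le]
    congr 1; field_simp
  rw [e] at b1 b2 b3 b4
  linarith

/-- Above the level `l`, the `q`-th powers of a sequence bounded in weak `ℓ_r` have a small sum. -/
theorem sum_filter_rpow_le_of_weakType [Fintype ι] {a : ι → ℝ} {q r K l : ℝ} (hq : 0 < q)
    (hqr : q < r) (hK : 0 ≤ K) (hl : 0 < l)
    (h : ∀ s, 0 < s → ((Finset.univ.filter fun j => s < a j).card : ℝ) ≤ K * s ^ (-r)) :
    ∑ j ∈ Finset.univ.filter (fun j => l < a j), a j ^ q ≤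
      2 ^ q / (1 - 2 ^ (q - r)) * K * l ^ (q - r) := by
  classical
  have h2 : (2 : ℝ) ^ (q - r) < 1 := Real.rpow_lt_one_of_one_lt_of_neg (by norm_num) (by linarith)
  obtain ⟨n, hn⟩ : ∃ n : ℕ, ∀ j, a j ≤ 2 ^ n * l := by
    obtain ⟨b, hb⟩ := (Set.finite_range a).bddAbove
    obtain ⟨n, hn⟩ := pow_unbounded_of_one_lt (b / l) (by norm_num : (1 : ℝ) < 2)
    refine ⟨n, fun j => (hb ⟨j, rfl⟩).trans ?_⟩
    rw [div_lt_iff₀ hl] at hn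
    exact hn.le
  -- Dyadic layers: `x` lies in some `(2^i l, 2^(i+1) l]`, and the summand of that layer alone
  -- dominates `x ^ q`.
  have hpt : ∀ n : ℕ, ∀ x : ℝ, l < x → x ≤ 2 ^ n * l →
      x ^ q ≤ ∑ i ∈ Finset.range n, if 2 ^ i * l < x then (2 ^ (i + 1) * l) ^ q else 0 := by
    intro n
    induction n with
    | zero => intro x h1 h2; simp at h2; linarith
    | succ n ih =>
      intro x h1 h2
      rw [Finset.sum_range_succ]
      by_cases hx : 2 ^ n * l < x
      · rw [if_pos hx]
        refine (Real.rpow_le_rpow (hl.trans h1).le h2 hq.le).trans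
          (le_add_of_nonneg_left (Finset.sum_nonneg fun i _ => ?_))
        split_ifs <;> positivity
      · rw [if_neg hx, add_zero]
        exact ih x h1 (not_lt.1 hx)
  calc ∑ j ∈ Finset.univ.filter (fun j => l < a j), a j ^ q
      ≤ ∑ j ∈ Finset.univ.filter (fun j => l < a j), ∑ i ∈ Finset.range n,
          (if 2 ^ i * l < a j then (2 ^ (i + 1) * l) ^ q else 0) :=
        Finset.sum_le_sum fun j hj => hpt n (a j) (Finset.mem_filter.1 hj).2 (hn j)
    _ ≤ ∑ j, ∑ i ∈ Finset.range n,
          (if 2 ^ i * l < a j then (2 ^ (i + 1) * l) ^ q else 0) := by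
        refine Finset.sum_le_sum_of_subset_of_nonneg (Finset.filter_subset _ _) fun j _ _ => ?_
        refine Finset.sum_nonneg fun i _ => ?_
        split_ifs <;> positivity
    _ = ∑ i ∈ Finset.range n, ∑ j, (if 2 ^ i * l < a j then (2 ^ (i + 1) * l) ^ q else 0) :=
        Finset.sum_comm
    _ ≤ ∑ i ∈ Finset.range n, (2 ^ q * K * l ^ (q - r)) * (2 ^ (q - r)) ^ i := by
        refine Finset.sum_le_sum fun i _ => ?_
        rw [← Finset.sum_filter, Finset.sum_const, nsmul_eq_mul]
        have hp : (0 : ℝ) < 2 ^ i := by positivity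
        calc _ ≤ K * (2 ^ i * l) ^ (-r) * (2 ^ (i + 1) * l) ^ q := by
              gcongr; exact h _ (by positivity)
          _ = _ := by
              rw [pow_succ, mul_comm ((2 : ℝ) ^ i) 2, mul_assoc 2, Real.mul_rpow (x := 2) (by norm_num) (by positivity),
                ← Real.rpow_natCast ((2 : ℝ) ^ (q - r)), ← Real.rpow_mul (by norm_num), mul_comm (q - r),
                Real.rpow_mul (by norm_num), Real.rpow_natCast]
              have : (2 ^ i * l) ^ (-r) * (2 ^ i * l) ^ q = l ^ (q - r) * ((2 : ℝ) ^ i) ^ (q - r) := by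
                rw [← Real.rpow_add (by positivity), Real.mul_rpow hp.le hl.le, neg_add_eq_sub, mul_comm]
              linear_combination (K * 2 ^ q) * this
    _ ≤ _ := by
        rw [← Finset.mul_sum]
        have hg : ∑ i ∈ Finset.range n, ((2 : ℝ) ^ (q - r)) ^ i ≤ (1 - 2 ^ (q - r))⁻¹ := by
          rw [← tsum_geometric_of_lt_one (by positivity) h2]
          exact (summable_geometric_of_lt_one (by positivity) h2).sum_le_tsum _
            fun i _ => by positivity
        calc _ ≤ 2 ^ q * K * l ^ (q - r) * (1 - 2 ^ (q - r))⁻¹ := by gcongr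
          _ = _ := by ring

end WeakType

/-! ### Lipschitz continuity of truncated powers. -/

section Truncation

/-- Convexity: Bernoulli's inequality for `y / x = 1 + (y / x - 1)`. -/
theorem rpow_sub_rpow_le {q x y : ℝ} (hq : 1 ≤ q) (hy : 0 ≤ y) (hyx : y ≤ x) :
    x ^ q - y ^ q ≤ q * x ^ (q - 1) * (x - y) := by
  rcases (hy.trans hyx).eq_or_lt with h0 | hx
  · obtain rfl : y = x := by linarith
    simp
  have h := one_add_mul_self_le_rpow_one_add (s := y / x - 1) (by linarith [div_nonneg hy hx.le]) hq
  rw [add_sub_cancel, Real.div_rpow hy hx.le, le_div_iff₀ (by positivity)] at h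
  have e : x ^ q = x ^ (q - 1) * x := by
    rw [← Real.rpow_add_one hx.ne']; simp
  have : (1 + q * (y / x - 1)) * x ^ q = x ^ q - q * x ^ (q - 1) * (x - y) := by
    rw [e]; field_simp; ring
  linarith

/-- The truncated power `min x l ^ q` is Lipschitz. -/
theorem abs_min_rpow_sub_min_rpow_le {q l x y : ℝ} (hq : 1 ≤ q) (hx : 0 ≤ x) (hy : 0 ≤ y)
    (hl : 0 ≤ l) : |min x l ^ q - min y l ^ q| ≤ q * l ^ (q - 1) * |x - y| := by
  wlog h : y ≤ x generalizing x y
  · rw [abs_sub_comm, abs_sub_comm x]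
    exact this hy hx (le_of_not_ge h)
  have h1 : min y l ≤ min x l := min_le_min_right _ h
  have h0 : 0 ≤ min y l := le_min hy hl
  rw [abs_of_nonneg (sub_nonneg.2 (Real.rpow_le_rpow h0 h1 (by linarith))),
    abs_of_nonneg (sub_nonneg.2 h)]
  refine (rpow_sub_rpow_le hq h0 h1).trans ?_
  have h2 : min x l - min y l ≤ x - y := by
    rcases le_total x l with hxl | hxl
    · rw [min_eq_left hxl, min_eq_left (h.trans hxl)]
    · rw [min_eq_right hxl]
      rcases le_total y l with hyl | hyl
      · rw [min_eq_left hyl]; linarith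
      · rw [min_eq_right hyl]; linarith
  have h3 : min x l ^ (q - 1) ≤ l ^ (q - 1) :=
    Real.rpow_le_rpow (le_min hx hl) (min_le_right _ _) (by linarith)
  have h4 : 0 ≤ min x l - min y l := sub_nonneg.2 h1
  have h5 : 0 ≤ l ^ (q - 1) := Real.rpow_nonneg hl _
  gcongr

end Truncation

/-! ### Nets of the unit ball. -/

section Net

/-- Volume comparison: the balls of radius `δ / 2` about the points are disjoint and lie in the ball
of radius `1 + δ / 2`. -/
theorem card_le_of_separated_unitBall {E : Type*} [NormedAddCommGroup E] [NormedSpace ℝ E]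
    [FiniteDimensional ℝ E] {δ : ℝ} (hδ : 0 < δ) (s : Finset E) (hs : ∀ c ∈ s, ‖c‖ ≤ 1)
    (h : ∀ c ∈ s, ∀ d ∈ s, c ≠ d → δ ≤ ‖c - d‖) :
    (s.card : ℝ) ≤ (1 + 2 / δ) ^ Module.finrank ℝ E := by
  borelize E
  let μ : Measure E := Measure.addHaar
  have hδ2 : 0 < δ / 2 := by positivity
  have hρ : 0 < 1 + δ / 2 := by positivity
  have D : Set.Pairwise (s : Set E) (Function.onFun Disjoint fun c => Metric.ball c (δ / 2)) := by
    intro c hc d hd hcd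
    apply Metric.ball_disjoint_ball
    rw [dist_eq_norm, add_halves]
    exact h c hc d hd hcd
  have hsub : (⋃ c ∈ s, Metric.ball c (δ / 2)) ⊆ Metric.ball (0 : E) (1 + δ / 2) := by
    refine Set.iUnion₂_subset fun x hx => Metric.ball_subset_ball' ?_
    rw [dist_zero_right]
    linarith [hs x hx]
  have I : (s.card : ℝ≥0∞) * ENNReal.ofReal ((δ / 2) ^ Module.finrank ℝ E) * μ (Metric.ball 0 1) ≤
      ENNReal.ofReal ((1 + δ / 2) ^ Module.finrank ℝ E) * μ (Metric.ball 0 1) := by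
    rw [← μ.addHaar_ball_of_pos (0 : E) hρ]
    refine le_trans (le_of_eq ?_) (measure_mono hsub)
    rw [measure_biUnion_finset D fun c _ => measurableSet_ball]
    simp only [μ.addHaar_ball_of_pos _ hδ2, Finset.sum_const, nsmul_eq_mul, mul_assoc]
  have J := (ENNReal.mul_le_mul_iff_left (Metric.measure_ball_pos _ _ zero_lt_one).ne'
    measure_ball_lt_top.ne).1 I
  have K := ENNReal.toReal_le_of_le_ofReal (pow_nonneg hρ.le _) J
  rw [ENNReal.toReal_mul, ENNReal.toReal_natCast, ENNReal.toReal_ofReal (by positivity),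
    ← le_div_iff₀ (by positivity), ← div_pow] at K
  have e : (1 + δ / 2) / (δ / 2) = 1 + 2 / δ := by field_simp; ring
  rwa [e] at K

/-- A separated set of maximal cardinality is a net; the volume bound guarantees that the maximum
exists. -/
theorem exists_net_unitBall (E : Type*) [NormedAddCommGroup E] [NormedSpace ℝ E]
    [FiniteDimensional ℝ E] {δ : ℝ} (hδ : 0 < δ) :
    ∃ s : Finset E, (∀ c ∈ s, ‖c‖ ≤ 1) ∧ (s.card : ℝ) ≤ (1 + 2 / δ) ^ Module.finrank ℝ E ∧
      ∀ x : E, ‖x‖ ≤ 1 → ∃ c ∈ s, ‖x - c‖ ≤ δ := by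
  classical
  let P : ℕ → Prop := fun n => ∃ s : Finset E, s.card = n ∧ (∀ c ∈ s, ‖c‖ ≤ 1) ∧
    ∀ c ∈ s, ∀ d ∈ s, c ≠ d → δ ≤ ‖c - d‖
  have hP0 : P 0 := ⟨∅, by simp⟩
  have hbd : ∀ n, P n → n ≤ ⌊(1 + 2 / δ) ^ Module.finrank ℝ E⌋₊ := by
    rintro n ⟨s, rfl, h1, h2⟩
    exact Nat.le_floor (card_le_of_separated_unitBall hδ s h1 h2)
  obtain ⟨s, hcard, h1, h2⟩ := Nat.findGreatest_spec (P := P) (hbd 0 hP0) hP0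
  refine ⟨s, h1, card_le_of_separated_unitBall hδ s h1 h2, fun x hx => ?_⟩
  by_contra! hcon
  have hxs : x ∉ s := fun hmem => by
    have := hcon x hmem
    rw [sub_self, norm_zero] at this
    linarith
  have hP : P (s.card + 1) := by
    refine ⟨insert x s, Finset.card_insert_of_notMem hxs, ?_, ?_⟩
    · intro c hc
      rcases Finset.mem_insert.1 hc with rfl | hc
      exacts [hx, h1 c hc]
    · intro c hc d hd hcd
      rcases Finset.mem_insert.1 hc with hc | hc <;> rcases Finset.mem_insert.1 hd with hd | hd
      · exact absurd (hc.trans hd.symm) hcd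
      · exact hc ▸ (hcon d hd).le
      · rw [norm_sub_rev]; exact hd ▸ (hcon c hc).le
      · exact h2 c hc d hd hcd
  have := Nat.le_findGreatest (P := P) (hbd _ hP) hP
  omega

end Net

/-! ### Independence and concentration for product measures. -/

section Sampling

variable {ι Ω : Type*} [Fintype ι] [MeasurableSpace Ω] {μ : Measure Ω} [IsProbabilityMeasure μ]

/-- If `Φ` does not depend on the coordinates in `J`, then the events `(Φ ω, ω j) ∈ A`, `j ∈ J`,
are independent given `Φ`. -/
theorem measure_pi_forall_mem_le {F : Type*} [MeasurableSpace F] [DecidableEq ι]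
    {Φ : (ι → Ω) → F} (hΦ : Measurable Φ) {A : Set (F × Ω)} (hA : MeasurableSet A) {a : ℝ≥0∞}
    (ha : ∀ c, μ {y | (c, y) ∈ A} ≤ a) (J : Finset ι)
    (hJ : ∀ j ∈ J, ∀ ω y, Φ (Function.update ω j y) = Φ ω) :
    Measure.pi (fun _ : ι => μ) {ω | ∀ j ∈ J, (Φ ω, ω j) ∈ A} ≤ a ^ J.card := by
  have hmeas : ∀ J : Finset ι, MeasurableSet {ω : ι → Ω | ∀ j ∈ J, (Φ ω, ω j) ∈ A} := by
    intro J
    have : {ω : ι → Ω | ∀ j ∈ J, (Φ ω, ω j) ∈ A} =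
        ⋂ j ∈ J, (fun ω : ι → Ω => (Φ ω, ω j)) ⁻¹' A := by ext; simp
    rw [this]
    exact Finset.measurableSet_biInter _ fun j _ => (hΦ.prodMk (measurable_pi_apply j)) hA
  induction J using Finset.induction_on with
  | empty => simp
  | insert i J hi ih =>
    have ih' := ih fun j hj => hJ j (Finset.mem_insert_of_mem hj)
    have hupd : ∀ (ω : ι → Ω) (y : Ω), Φ (Function.update ω i y) = Φ ω :=
      hJ i (Finset.mem_insert_self _ _)
    have hupd' : ∀ (ω : ι → Ω) (y : Ω), (∀ j ∈ J, (Φ (Function.update ω i y),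
        Function.update ω i y j) ∈ A) ↔ ∀ j ∈ J, (Φ ω, ω j) ∈ A := by
      intro ω y
      refine forall₂_congr fun j hj => ?_
      rw [hupd, Function.update_of_ne (ne_of_mem_of_not_mem hj hi)]
    set B := {ω : ι → Ω | ∀ j ∈ J, (Φ ω, ω j) ∈ A} with hB
    have hupdB : ∀ (ω : ι → Ω) (y : Ω), Function.update ω i y ∈ B ↔ ω ∈ B := hupd'
    have hle : ∫⁻ ω, Set.indicator {ω : ι → Ω | ∀ j ∈ insert i J, (Φ ω, ω j) ∈ A} 1 ω
        ∂Measure.pi (fun _ : ι => μ) ≤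
        ∫⁻ ω, a * Set.indicator B 1 ω ∂Measure.pi (fun _ : ι => μ) := by
      -- Integrate out coordinate `i` alone: neither `Φ` nor the conditions indexed by `J` see it,
      -- so it contributes a factor of at most `a`.
      refine lintegral_le_of_lmarginal_le {i} (measurable_one.indicator (hmeas _))
        ((measurable_one.indicator (hmeas _)).const_mul _) ?_
      rw [lmarginal_singleton, lmarginal_singleton]
      intro ω
      have e2 : ∀ y, B.indicator (1 : (ι → Ω) → ℝ≥0∞) (Function.update ω i y) =
          B.indicator 1 ω := by
        intro y
        by_cases hω : ω ∈ B
        · rw [Set.indicator_of_mem hω, Set.indicator_of_mem ((hupdB ω y).2 hω), Pi.one_apply,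
            Pi.one_apply]
        · rw [Set.indicator_of_notMem hω, Set.indicator_of_notMem fun h => hω ((hupdB ω y).1 h)]
      simp only [e2, lintegral_const, measure_univ, mul_one]
      by_cases hω : ω ∈ B
      · rw [Set.indicator_of_mem hω, Pi.one_apply, mul_one]
        refine le_trans (le_of_eq ?_) (ha (Φ ω))
        have hAm : MeasurableSet {y | (Φ ω, y) ∈ A} := measurable_prodMk_left hA
        rw [← lintegral_indicator_one hAm]
        refine lintegral_congr fun y => ?_
        have : Function.update ω i y ∈ {ω : ι → Ω | ∀ j ∈ insert i J, (Φ ω, ω j) ∈ A} ↔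
            y ∈ {y | (Φ ω, y) ∈ A} := by
          rw [Set.mem_ofPred_eq, Finset.forall_mem_insert, hupd' ω y, Function.update_self, hupd]
          exact and_iff_left hω
        by_cases hy : y ∈ {y | (Φ ω, y) ∈ A}
        · rw [Set.indicator_of_mem hy, Set.indicator_of_mem (this.2 hy), Pi.one_apply, Pi.one_apply]
        · rw [Set.indicator_of_notMem hy, Set.indicator_of_notMem (fun h => hy (this.1 h))]
      · rw [Set.indicator_of_notMem hω, mul_zero, nonpos_iff_eq_zero, ← nonpos_iff_eq_zero]
        refine (lintegral_mono (g := fun _ => 0) fun y => ?_).trans (by simp)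
        rw [Set.indicator_of_notMem]
        intro h
        exact hω ((hupd' ω y).1 fun j hj => h j (Finset.mem_insert_of_mem hj))
    rw [lintegral_indicator_one (hmeas _), lintegral_const_mul _ (measurable_one.indicator (hmeas _)),
      lintegral_indicator_one (hmeas _)] at hle
    rw [Finset.card_insert_of_notMem hi, pow_succ']
    exact hle.trans (mul_le_mul_right ih' _)

open ProbabilityTheory in
-- Hoeffding's inequality: a variable with values in `[a, b]` is sub-Gaussian with variance proxy
-- `((b - a) / 2)²`.
theorem measure_pi_le_sum_sub_le_exp {g : Ω → ℝ} (hg : Measurable g) {a b : ℝ}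
    (hab : ∀ x, g x ∈ Set.Icc a b) {η : ℝ} (hη : 0 ≤ η) :
    (Measure.pi (fun _ : ι => μ)).real {ω | Fintype.card ι * η ≤ ∑ j, (g (ω j) - ∫ x, g x ∂μ)} ≤
      Real.exp (-(2 * Fintype.card ι * η ^ 2 / (b - a) ^ 2)) := by
  have hind : iIndepFun (fun (j : ι) (ω : ι → Ω) => g (ω j) - ∫ x, g x ∂μ)
      (Measure.pi (fun _ : ι => μ)) :=
    iIndepFun_pi (X := fun _ x => g x - ∫ x, g x ∂μ) fun _ => (hg.sub_const _).aemeasurable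
  have hsub : ∀ j ∈ (Finset.univ : Finset ι), HasSubgaussianMGF
      (fun ω : ι → Ω => g (ω j) - ∫ x, g x ∂μ) ((‖b - a‖₊ / 2) ^ 2)
      (Measure.pi (fun _ : ι => μ)) := by
    intro j _
    have h := hasSubgaussianMGF_of_mem_Icc (μ := Measure.pi (fun _ : ι => μ))
      (X := fun ω => g (ω j)) (hg.comp (measurable_pi_apply j)).aemeasurable
      (Filter.Eventually.of_forall fun ω => hab (ω j))
    have e : ∫ ω, g (ω j) ∂Measure.pi (fun _ : ι => μ) = ∫ x, g x ∂μ := by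
      exact integral_comp_eval (μ := fun _ : ι => μ) (i := j) hg.aestronglyMeasurable
    rwa [e] at h
  refine (HasSubgaussianMGF.measure_sum_ge_le_of_iIndepFun hind hsub (by positivity)).trans
    (le_of_eq ?_)
  congr 1
  simp only [Finset.sum_const, Finset.card_univ, nsmul_eq_mul]
  push_cast
  rw [div_pow, Real.norm_eq_abs, sq_abs]
  rcases eq_or_ne (Fintype.card ι : ℝ) 0 with h0 | h0
  · rw [h0]; simp
  rcases eq_or_ne (b - a) 0 with h1 | h1
  · rw [h1]; simp
  field_simp

theorem measure_pi_le_abs_average_sub_le_exp [Nonempty ι] {g : Ω → ℝ} (hg : Measurable g) {b : ℝ}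
    (hab : ∀ x, g x ∈ Set.Icc 0 b) {η : ℝ} (hη : 0 ≤ η) :
    (Measure.pi (fun _ : ι => μ)).real
      {ω | η ≤ |1 / (Fintype.card ι : ℝ) * ∑ j, g (ω j) - ∫ x, g x ∂μ|} ≤
      2 * Real.exp (-(2 * Fintype.card ι * η ^ 2 / b ^ 2)) := by
  have h1 := measure_pi_le_sum_sub_le_exp (ι := ι) (μ := μ) hg hab hη
  have h2 := measure_pi_le_sum_sub_le_exp (ι := ι) (μ := μ) hg.neg (a := -b) (b := 0)
    (fun x => ⟨neg_le_neg (hab x).2, neg_nonpos.2 (hab x).1⟩) hη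
  rw [sub_zero] at h1
  rw [zero_sub, neg_neg] at h2
  have hm : (0 : ℝ) < Fintype.card ι := by exact_mod_cast Fintype.card_pos
  refine le_trans (measureReal_mono ?_) ((measureReal_union_le _ _).trans
    ((add_le_add h1 h2).trans_eq (two_mul _).symm))
  intro ω hω
  have hsum : 1 / (Fintype.card ι : ℝ) * ∑ j, g (ω j) - ∫ x, g x ∂μ =
      (∑ j, (g (ω j) - ∫ x, g x ∂μ)) / Fintype.card ι := by
    rw [Finset.sum_sub_distrib, Finset.sum_const, Finset.card_univ, nsmul_eq_mul]
    field_simp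
  simp only [Set.mem_ofPred_eq, hsum, abs_div, abs_of_pos hm, le_div_iff₀ hm] at hω
  rcases le_abs.1 hω with h | h
  · left; simpa [mul_comm] using h
  · right
    simp only [Set.mem_ofPred_eq, Pi.neg_apply, integral_neg]
    rw [← Finset.sum_neg_distrib] at h
    calc _ ≤ _ := (mul_comm _ _).trans_le h
      _ = _ := Finset.sum_congr rfl fun j _ => by ring

end Sampling

/-! ### Counting pairs of index sets for the union bound. -/

section Counting

variable {ι : Type*} [Fintype ι]

theorem sum_card_pow_le_exp (k : ℕ) :
    ∑ I : Finset ι, ((k : ℝ) / Fintype.card ι) ^ I.card ≤ Real.exp k := by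
  have h := Fintype.sum_pow_mul_eq_add_pow ι ((k : ℝ) / Fintype.card ι) 1
  simp only [one_pow, mul_one] at h
  rw [h, add_comm]
  rcases Nat.eq_zero_or_pos (Fintype.card ι) with h0 | h0
  · rw [h0, pow_zero]; exact Real.one_le_exp (by positivity)
  have h0' : (0 : ℝ) < Fintype.card ι := by exact_mod_cast h0
  calc (1 + (k : ℝ) / Fintype.card ι) ^ Fintype.card ι
      ≤ Real.exp ((k : ℝ) / Fintype.card ι) ^ Fintype.card ι := by
        gcongr
        rw [add_comm]; exact Real.add_one_le_exp _
    _ = Real.exp k := by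
        rw [← Real.exp_nat_mul]; congr 1; field_simp

/-- With `y = k / m ≤ 1`, where `m` is the size of `ι`, each set counted has `y ^ l ≤ y ^ |I|`, and
the sum of `y ^ |I|` over all sets is `(1 + y) ^ m ≤ exp k`. -/
theorem card_filter_card_le_mul_le_exp {k l : ℕ} (hk : k ≤ Fintype.card ι) :
    ((Finset.univ.filter fun I : Finset ι => I.card ≤ l).card : ℝ) *
      ((k : ℝ) / Fintype.card ι) ^ l ≤ Real.exp k := by
  have hy0 : (0 : ℝ) ≤ (k : ℝ) / Fintype.card ι := by positivity
  have hy1 : (k : ℝ) / Fintype.card ι ≤ 1 :=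
    div_le_one_of_le₀ (by exact_mod_cast hk) (by positivity)
  rw [← nsmul_eq_mul]
  calc _ ≤ ∑ I ∈ Finset.univ.filter fun I : Finset ι => I.card ≤ l,
        ((k : ℝ) / Fintype.card ι) ^ I.card :=
        Finset.card_nsmul_le_sum _ _ _ fun I hI =>
          pow_le_pow_of_le_one hy0 hy1 (Finset.mem_filter.1 hI).2
    _ ≤ ∑ I : Finset ι, ((k : ℝ) / Fintype.card ι) ^ I.card :=
        Finset.sum_le_sum_of_subset_of_nonneg (Finset.filter_subset _ _) fun _ _ _ => by positivity
    _ ≤ _ := sum_card_pow_le_exp k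

/-- For `|J| = k`, two of the three powers of `k / m` pay for choosing `I`, the third for choosing
`J`. Each choice costs `exp k`, leaving `(e² / 30) ^ k ≤ 4 ^ (-k)`, and these sum to at most `1 /
3`. -/
theorem sum_sum_sparse_le :
    ∑ J ∈ Finset.univ.filter (fun J : Finset ι => J.Nonempty),
      ∑ _I ∈ Finset.univ.filter (fun I : Finset ι => I.card ≤ 2 * J.card),
        (1 / 30 * ((J.card : ℝ) / Fintype.card ι) ^ 3) ^ J.card ≤ 1 / 3 := by
  classical
  set m := Fintype.card ι with hm
  have he : Real.exp 2 / 30 ≤ 1 / 4 := by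
    have h1 := Real.exp_one_lt_d9
    have h2 : Real.exp 2 = Real.exp 1 * Real.exp 1 := by rw [← Real.exp_add]; norm_num
    have h3 := Real.exp_pos 1
    rw [h2]
    nlinarith
  have step : ∀ J : Finset ι, J.Nonempty →
      ∑ _I ∈ Finset.univ.filter (fun I : Finset ι => I.card ≤ 2 * J.card),
        (1 / 30 * ((J.card : ℝ) / m) ^ 3) ^ J.card ≤
      Real.exp J.card * (1 / 30) ^ J.card * ((J.card : ℝ) / m) ^ J.card := by
    intro J hJ
    have := card_filter_card_le_mul_le_exp (ι := ι) (l := 2 * J.card) (Finset.card_le_univ J)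
    rw [Finset.sum_const, nsmul_eq_mul]
    calc _ = ((Finset.univ.filter fun I : Finset ι => I.card ≤ 2 * J.card).card : ℝ) *
          ((J.card : ℝ) / m) ^ (2 * J.card) * (1 / 30) ^ J.card * ((J.card : ℝ) / m) ^ J.card := by
          rw [mul_pow, ← pow_mul, show 3 * J.card = 2 * J.card + J.card by ring, pow_add]; ring
      _ ≤ _ := by gcongr
  refine (Finset.sum_le_sum fun J hJ => step J (Finset.mem_filter.1 hJ).2).trans ?_
  have hmaps : ∀ J ∈ Finset.univ.filter (fun J : Finset ι => J.Nonempty),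
      J.card ∈ Finset.Icc 1 m := fun J hJ =>
    Finset.mem_Icc.2 ⟨(Finset.mem_filter.1 hJ).2.card_pos, Finset.card_le_univ J⟩
  rw [← Finset.sum_fiberwise_of_maps_to hmaps]
  calc _ ≤ ∑ k ∈ Finset.Icc 1 m, (1 / 4 : ℝ) ^ k := by
        refine Finset.sum_le_sum fun k hk => ?_
        have hkm := (Finset.mem_Icc.1 hk).2
        calc _ ≤ ∑ J ∈ Finset.univ.filter (fun I : Finset ι => I.card ≤ k),
              Real.exp k * (1 / 30) ^ k * ((k : ℝ) / m) ^ k := by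
              rw [Finset.sum_congr rfl fun J hJ => by rw [(Finset.mem_filter.1 hJ).2]]
              refine Finset.sum_le_sum_of_subset_of_nonneg ?_ fun _ _ _ => by positivity
              intro J hJ
              exact Finset.mem_filter.2 ⟨Finset.mem_univ _, (Finset.mem_filter.1 hJ).2.le⟩
          _ = Real.exp k * (1 / 30) ^ k *
              (((Finset.univ.filter fun I : Finset ι => I.card ≤ k).card : ℝ) *
                ((k : ℝ) / m) ^ k) := by rw [Finset.sum_const, nsmul_eq_mul]; ring
          _ ≤ Real.exp k * (1 / 30) ^ k * Real.exp k := by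
              gcongr; exact card_filter_card_le_mul_le_exp hkm
          _ = (Real.exp 2 / 30) ^ k := by
              rw [div_pow (Real.exp 2), ← Real.exp_nat_mul, mul_two, Real.exp_add, one_div, inv_pow]
              ring
          _ ≤ (1 / 4) ^ k := by gcongr
    _ = ∑ k ∈ Finset.range m, (1 / 4 : ℝ) * (1 / 4) ^ k := by
        rw [Finset.range_eq_Ico, Finset.sum_Ico_eq_sum_range, ← Finset.Ico_add_one_right_eq_Icc,
          Finset.sum_Ico_eq_sum_range]
        simp only [Nat.add_sub_cancel, Nat.sub_zero, zero_add]
        exact Finset.sum_congr rfl fun k _ => by rw [pow_add, pow_one]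
    _ ≤ 1 / 3 := by
        rw [← Finset.mul_sum]
        have : ∑ k ∈ Finset.range m, (1 / 4 : ℝ) ^ k ≤ (1 - 1 / 4)⁻¹ := by
          rw [← tsum_geometric_of_lt_one (by norm_num) (by norm_num)]
          exact (summable_geometric_of_lt_one (by norm_num) (by norm_num)).sum_le_tsum _
            fun i _ => by positivity
        linarith

end Counting

/-! ### Random families are sparsely correlated. -/

section RandomFamily

variable {𝕜 E Ω ι : Type*} [RCLike 𝕜] [NormedAddCommGroup E] [InnerProductSpace 𝕜 E]
  [SecondCountableTopology E] [MeasurableSpace E] [BorelSpace E]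
  [MeasurableSpace Ω] {μ : Measure Ω}

/-- Markov's inequality for the `p`-th power. -/
theorem measure_lt_norm_inner_le {v : Ω → E} (hv : Measurable v) {p B : ℝ} (hp : 0 < p)
    (hB : 0 < B) {c : E} (hmom : ∫⁻ x, ‖inner 𝕜 (v x) c‖ₑ ^ p ∂μ ≤ ENNReal.ofReal (B * ‖c‖) ^ p)
    {s : ℝ} (hs : 0 < s) :
    μ {x | s * ‖c‖ < ‖inner 𝕜 (v x) c‖} ≤ ENNReal.ofReal ((B / s) ^ p) := by
  rcases eq_or_ne c 0 with rfl | hc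
  · simp
  have hc' : 0 < ‖c‖ := norm_pos_iff.2 hc
  have hmeas : Measurable fun x => ‖inner 𝕜 (v x) c‖ₑ ^ p :=
    ((hv.inner_const).enorm).pow_const p
  have h := mul_meas_ge_le_lintegral₀ hmeas.aemeasurable (ENNReal.ofReal (s * ‖c‖) ^ p)
    (μ := μ)
  have hpos : ENNReal.ofReal (s * ‖c‖) ^ p ≠ 0 := by
    rw [ENNReal.ofReal_rpow_of_pos (by positivity)]
    exact (ENNReal.ofReal_pos.2 (by positivity)).ne'
  have htop : ENNReal.ofReal (s * ‖c‖) ^ p ≠ ∞ :=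
    ENNReal.rpow_ne_top_of_nonneg hp.le ENNReal.ofReal_ne_top
  calc μ {x | s * ‖c‖ < ‖inner 𝕜 (v x) c‖}
      ≤ μ {x | ENNReal.ofReal (s * ‖c‖) ^ p ≤ ‖inner 𝕜 (v x) c‖ₑ ^ p} := by
        refine measure_mono fun x hx => ?_
        rw [Set.mem_ofPred_eq] at hx ⊢
        rw [← ofReal_norm]
        gcongr
    _ ≤ ENNReal.ofReal (B * ‖c‖) ^ p / ENNReal.ofReal (s * ‖c‖) ^ p := by
        rw [ENNReal.le_div_iff_mul_le (Or.inl hpos) (Or.inl htop), mul_comm]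
        exact h.trans hmom
    _ = ENNReal.ofReal ((B / s) ^ p) := by
        rw [ENNReal.ofReal_rpow_of_pos (by positivity), ENNReal.ofReal_rpow_of_pos (by positivity),
          ← ENNReal.ofReal_div_of_pos (by positivity), ← Real.div_rpow (by positivity) (by positivity)]
        congr 2
        field_simp

/-- Independent copies of a random vector with bounded `p`-th moments are sparsely correlated with
probability at least `2 / 3`. -/
theorem measure_not_sparselyCorrelated_le [IsProbabilityMeasure μ] [Fintype ι] {v : Ω → E}
    (hv : Measurable v) {p B α : ℝ} (hp : 1 ≤ p) (hB : 0 < B) (hα : 3 ≤ p * (1 - α))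
    (hmom : ∀ c, ∫⁻ x, ‖inner 𝕜 (v x) c‖ₑ ^ p ∂μ ≤ ENNReal.ofReal (B * ‖c‖) ^ p) :
    Measure.pi (fun _ : ι => μ)
      {ω | ¬ SparselyCorrelated 𝕜 (fun j => v (ω j)) α (30 * B) (Fintype.card ι)} ≤
        ENNReal.ofReal (1 / 3) := by
  classical
  set m := Fintype.card ι with hm
  set S := 30 * B with hS
  have hpair : ∀ I J : Finset ι, Disjoint I J → J.Nonempty →
      Measure.pi (fun _ : ι => μ) {ω | ∀ j ∈ J, S * sparseGauge α m J.card / J.card *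
        ‖∑ i ∈ I, v (ω i)‖ < ‖inner 𝕜 (v (ω j)) (∑ i ∈ I, v (ω i))‖} ≤
      ENNReal.ofReal ((1 / 30 * ((J.card : ℝ) / m) ^ 3) ^ J.card) := by
    intro I J hd hJ
    have hk : 0 < J.card := hJ.card_pos
    have hkm : J.card ≤ m := Finset.card_le_univ J
    have hm0 : 0 < m := hk.trans_le hkm
    have hk' : (0 : ℝ) < J.card := by exact_mod_cast hk
    have hm' : (0 : ℝ) < m := by exact_mod_cast hm0
    have hkm' : (J.card : ℝ) / m ≤ 1 := div_le_one_of_le₀ (by exact_mod_cast hkm) hm'.le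
    set s := S * sparseGauge α m J.card / J.card with hs
    have hs0 : 0 < s := by
      have := sparseGauge_pos (α := α) hm0 hk
      positivity
    have hB' : ENNReal.ofReal ((B / s) ^ p) ≤ ENNReal.ofReal (1 / 30 * ((J.card : ℝ) / m) ^ 3) := by
      apply ENNReal.ofReal_le_ofReal
      have e : B / s = 1 / 30 * ((J.card : ℝ) / m) ^ (1 - α) := by
        rw [hs, hS, Real.div_rpow hk'.le hm'.le, Real.rpow_sub hk', Real.rpow_one]
        unfold sparseGauge
        have h1 : (0 : ℝ) < (J.card : ℝ) ^ α := by positivity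
        have h2 : (0 : ℝ) < (m : ℝ) ^ (1 - α) := by positivity
        field_simp
      rw [e, Real.mul_rpow (by norm_num) (by positivity), ← Real.rpow_mul (by positivity)]
      have h1 : (1 / 30 : ℝ) ^ p ≤ 1 / 30 := by
        conv_rhs => rw [← Real.rpow_one (1 / 30)]
        exact Real.rpow_le_rpow_of_exponent_ge (by norm_num) (by norm_num) hp
      have h2 : ((J.card : ℝ) / m) ^ ((1 - α) * p) ≤ ((J.card : ℝ) / m) ^ 3 := by
        rw [← Real.rpow_natCast]
        exact Real.rpow_le_rpow_of_exponent_ge (by positivity) hkm' (by push_cast; linarith)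
      gcongr
    have hΦ : Measurable fun ω : ι → Ω => ∑ i ∈ I, v (ω i) :=
      Finset.measurable_sum _ fun i _ => hv.comp (measurable_pi_apply i)
    have hA : MeasurableSet {z : E × Ω | s * ‖z.1‖ < ‖inner 𝕜 (v z.2) z.1‖} := by
      apply measurableSet_lt
      · fun_prop
      · exact (Measurable.inner (hv.comp measurable_snd) measurable_fst).norm
    refine (measure_pi_forall_mem_le hΦ hA (a := ENNReal.ofReal (1 / 30 * ((J.card : ℝ) / m) ^ 3))
      (fun c => (measure_lt_norm_inner_le hv (by linarith) hB (hmom c) hs0).trans hB') J ?_).trans_eq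
      (ENNReal.ofReal_pow (by positivity) _).symm
    -- The sum over `I` ignores the coordinates in `J`, since the two sets are disjoint.
    intro j hj ω y
    refine Finset.sum_congr rfl fun i hi => ?_
    rw [Function.update_of_ne (ne_of_mem_of_not_mem hi (Finset.disjoint_right.1 hd hj))]
  have hsub : {ω : ι → Ω | ¬ SparselyCorrelated 𝕜 (fun j => v (ω j)) α S m} ⊆
      ⋃ J ∈ Finset.univ.filter (fun J : Finset ι => J.Nonempty),
        ⋃ I ∈ Finset.univ.filter (fun I : Finset ι => I.card ≤ 2 * J.card),
          {ω | Disjoint I J ∧ ∀ j ∈ J, S * sparseGauge α m J.card / J.card *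
            ‖∑ i ∈ I, v (ω i)‖ < ‖inner 𝕜 (v (ω j)) (∑ i ∈ I, v (ω i))‖} := by
    intro ω hω
    rw [Set.mem_ofPred_eq, SparselyCorrelated] at hω
    push Not at hω
    obtain ⟨I, J, hd, hJ, hIJ, h⟩ := hω
    simp only [Set.mem_iUnion, Finset.mem_filter, Finset.mem_univ, true_and, Set.mem_ofPred_eq]
    refine ⟨J, hJ, I, hIJ, hd, fun j hj => ?_⟩
    have hk' : (0 : ℝ) < J.card := by exact_mod_cast hJ.card_pos
    rw [div_mul_eq_mul_div, div_lt_iff₀ hk']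
    exact h j hj
  refine (measure_mono hsub).trans ((measure_biUnion_finset_le _ _).trans ?_)
  calc _ ≤ ∑ J ∈ Finset.univ.filter (fun J : Finset ι => J.Nonempty),
        ∑ _I ∈ Finset.univ.filter (fun I : Finset ι => I.card ≤ 2 * J.card),
          ENNReal.ofReal ((1 / 30 * ((J.card : ℝ) / m) ^ 3) ^ J.card) := by
        refine Finset.sum_le_sum fun J hJ => (measure_biUnion_finset_le _ _).trans
          (Finset.sum_le_sum fun I _ => ?_)
        by_cases hd : Disjoint I J
        · exact (measure_mono fun ω hω => hω.2).trans (hpair I J hd (Finset.mem_filter.1 hJ).2)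
        · simp [hd]
    _ = ENNReal.ofReal (∑ J ∈ Finset.univ.filter (fun J : Finset ι => J.Nonempty),
        ∑ _I ∈ Finset.univ.filter (fun I : Finset ι => I.card ≤ 2 * J.card),
          (1 / 30 * ((J.card : ℝ) / m) ^ 3) ^ J.card) := by
        rw [ENNReal.ofReal_sum_of_nonneg fun _ _ => Finset.sum_nonneg fun _ _ => by positivity]
        exact Finset.sum_congr rfl fun J _ =>
          (ENNReal.ofReal_sum_of_nonneg fun _ _ => by positivity).symm
    _ ≤ _ := ENNReal.ofReal_le_ofReal sum_sum_sparse_le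

end RandomFamily

/-! ### Reduction to truncated powers on a net. -/

section Discretization

variable {𝕜 E Ω ι : Type*} [RCLike 𝕜] [NormedAddCommGroup E] [InnerProductSpace 𝕜 E]
  [MeasurableSpace Ω] {μ : Measure Ω} [IsProbabilityMeasure μ] [Fintype ι]

theorem rpow_le_min_rpow_add {q l x : ℝ} (hq : q ≤ 2) (hl : 0 < l) :
    x ^ q ≤ min x l ^ q + l ^ (q - 2) * x ^ 2 := by
  rcases le_or_gt x l with h | h
  · rw [min_eq_left h]
    have : 0 ≤ l ^ (q - 2) * x ^ 2 := by positivity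
    linarith
  · have hx0 : 0 < x := hl.trans h
    rw [min_eq_right h.le]
    have h1 : x ^ (q - 2) ≤ l ^ (q - 2) := Real.rpow_le_rpow_of_nonpos hl h.le (by linarith)
    have h2 : x ^ q = x ^ (q - 2) * x ^ 2 := by
      rw [← Real.rpow_natCast x 2, ← Real.rpow_add hx0]; congr 1; push_cast; ring
    have h3 : 0 ≤ l ^ q := by positivity
    rw [h2]
    have : x ^ (q - 2) * x ^ 2 ≤ l ^ (q - 2) * x ^ 2 := by gcongr
    linarith

theorem integrable_norm_rpow_of_le_two {f : Ω → 𝕜} {q : ℝ} (hq0 : 0 < q) (hq : q ≤ 2)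
    (hf : MemLp f 2 μ) : Integrable (fun x => ‖f x‖ ^ q) μ := by
  have h : MemLp f (ENNReal.ofReal q) μ := hf.mono_exponent (by
    rw [show (2 : ℝ≥0∞) = ENNReal.ofReal 2 by simp]
    exact ENNReal.ofReal_le_ofReal hq)
  have := h.integrable_norm_rpow (by simpa using hq0) ENNReal.ofReal_ne_top
  rwa [ENNReal.toReal_ofReal hq0.le] at this

theorem integral_norm_le_of_integral_sq_le {f : Ω → 𝕜} (hf : MemLp f 2 μ) {a : ℝ} (ha : 0 < a)
    (h : ∫ x, ‖f x‖ ^ 2 ∂μ ≤ a ^ 2) : ∫ x, ‖f x‖ ∂μ ≤ a := by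
  have h2 : Integrable (fun x => ‖f x‖ ^ 2) μ := hf.integrable_norm_pow (by norm_num)
  have h1 : Integrable (fun x => ‖f x‖) μ := (hf.integrable (by norm_num)).norm
  calc ∫ x, ‖f x‖ ∂μ ≤ ∫ x, (‖f x‖ ^ 2 / (2 * a) + a / 2) ∂μ := by
        refine integral_mono h1 ((h2.div_const _).add (integrable_const _)) fun x => ?_
        have : ‖f x‖ ^ 2 / (2 * a) + a / 2 - ‖f x‖ = (‖f x‖ - a) ^ 2 / (2 * a) := by
          field_simp; ring
        have h0 : 0 ≤ (‖f x‖ - a) ^ 2 / (2 * a) := by positivity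
        simp only
        linarith
    _ = (∫ x, ‖f x‖ ^ 2 ∂μ) / (2 * a) + a / 2 := by
        rw [integral_add (h2.div_const _) (integrable_const _), integral_div]
        simp
    _ ≤ a ^ 2 / (2 * a) + a / 2 := by gcongr
    _ = a := by field_simp; ring

/-- Weak `ℓ_r` bounds reduce discretization on the unit sphere to discretization of truncated powers
on a `δ`-net of the unit ball. -/
theorem abs_average_sub_integral_le [Nonempty ι] {v : Ω → E} {w : ι → E} {q r K l δ η : ℝ}
    (hq1 : 1 ≤ q) (hqr : q < r) (hr2 : r ≤ 2) (hK : 0 ≤ K) (hl : 0 < l) (hδ : 0 < δ)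
    (hweak : ∀ (c : E) (s : ℝ), 0 < s →
      ((Finset.univ.filter fun j => s < ‖inner 𝕜 (w j) c‖).card : ℝ) ≤
        K * ‖c‖ ^ r * Fintype.card ι * s ^ (-r))
    (hmem : ∀ c, MemLp (fun x => inner 𝕜 (v x) c) 2 μ)
    (hL2 : ∀ c, ∫ x, ‖inner 𝕜 (v x) c‖ ^ 2 ∂μ ≤ ‖c‖ ^ 2)
    {c g : E} (hc : ‖c‖ = 1) (hcg : ‖c - g‖ ≤ δ)
    (hg : |1 / (Fintype.card ι : ℝ) * ∑ j, min ‖inner 𝕜 (w j) g‖ l ^ q -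
      ∫ x, min ‖inner 𝕜 (v x) g‖ l ^ q ∂μ| ≤ η) :
    |1 / (Fintype.card ι : ℝ) * ∑ j, ‖inner 𝕜 (w j) c‖ ^ q - ∫ x, ‖inner 𝕜 (v x) c‖ ^ q ∂μ| ≤
      2 ^ q / (1 - 2 ^ (q - r)) * K * l ^ (q - r) + l ^ (q - 2) + η +
        q * l ^ (q - 1) * δ * (2 + 2 / (1 - 2 ^ (1 - r)) * K) := by
  have hm : (0 : ℝ) < Fintype.card ι := by exact_mod_cast Fintype.card_pos
  set m : ℝ := (Fintype.card ι : ℝ) with hmdef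
  have hq0 : 0 < q := by linarith
  have hr0 : 0 < r := by linarith
  set D := q * l ^ (q - 1) with hD
  have hD0 : 0 ≤ D := by positivity
  have hmin0 : ∀ z : 𝕜, 0 ≤ min ‖z‖ l := fun z => le_min (norm_nonneg _) hl.le
  have hminle : ∀ z : 𝕜, min ‖z‖ l ^ q ≤ ‖z‖ ^ q := fun z =>
    Real.rpow_le_rpow (hmin0 z) (min_le_left _ _) hq0.le
  have hLip : ∀ u : E, |min ‖inner 𝕜 u c‖ l ^ q - min ‖inner 𝕜 u g‖ l ^ q| ≤
      D * ‖inner 𝕜 u (c - g)‖ := by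
    intro u
    refine (abs_min_rpow_sub_min_rpow_le hq1 (norm_nonneg _) (norm_nonneg _) hl.le).trans ?_
    rw [inner_sub_right]
    exact mul_le_mul_of_nonneg_left (abs_norm_sub_norm_le _ _) hD0
  have hmeas : ∀ c : E, AEStronglyMeasurable (fun x => min ‖inner 𝕜 (v x) c‖ l ^ q) μ := fun c =>
    (((hmem c).1.norm.aemeasurable.min aemeasurable_const).pow_const q).aestronglyMeasurable
  have hint : ∀ c : E, Integrable (fun x => min ‖inner 𝕜 (v x) c‖ l ^ q) μ := by
    intro c
    refine (integrable_norm_rpow_of_le_two hq0 (by linarith) (hmem c)).mono (hmeas c)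
      (Filter.Eventually.of_forall fun x => ?_)
    rw [Real.norm_of_nonneg (Real.rpow_nonneg (hmin0 _) _), Real.norm_of_nonneg (by positivity)]
    exact hminle _
  -- tail of the average
  have t1 : |1 / m * ∑ j, ‖inner 𝕜 (w j) c‖ ^ q - 1 / m * ∑ j, min ‖inner 𝕜 (w j) c‖ l ^ q| ≤
      2 ^ q / (1 - 2 ^ (q - r)) * K * l ^ (q - r) := by
    rw [← mul_sub, ← Finset.sum_sub_distrib, abs_of_nonneg (mul_nonneg (by positivity)
      (Finset.sum_nonneg fun j _ => sub_nonneg.2 (hminle _)))]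
    have h1 : ∑ j, (‖inner 𝕜 (w j) c‖ ^ q - min ‖inner 𝕜 (w j) c‖ l ^ q) ≤
        ∑ j ∈ Finset.univ.filter (fun j => l < ‖inner 𝕜 (w j) c‖), ‖inner 𝕜 (w j) c‖ ^ q := by
      rw [Finset.sum_filter]
      refine Finset.sum_le_sum fun j _ => ?_
      split_ifs with h
      · linarith [Real.rpow_nonneg (hmin0 (inner 𝕜 (w j) c)) q]
      · rw [min_eq_left (not_lt.1 h), sub_self]
    have h2 := sum_filter_rpow_le_of_weakType hq0 hqr (K := K * m) (by positivity) hl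
      (a := fun j => ‖inner 𝕜 (w j) c‖) (fun s hs => by simpa [hc] using hweak c s hs)
    calc _ ≤ 1 / m * (2 ^ q / (1 - 2 ^ (q - r)) * (K * m) * l ^ (q - r)) := by
          gcongr; exact h1.trans h2
      _ = _ := by field_simp
  -- truncated average
  have hL1 : ∑ j, ‖inner 𝕜 (w j) (c - g)‖ ≤ m * (δ * (1 + 2 / (1 - 2 ^ (1 - r)) * K)) := by
    rw [← Finset.sum_filter_add_sum_filter_not _ (fun j => δ < ‖inner 𝕜 (w j) (c - g)‖)]
    have h1 := sum_filter_rpow_le_of_weakType (q := 1) one_pos (by linarith) (r := r)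
      (K := K * δ ^ r * m) (by positivity) hδ (a := fun j => ‖inner 𝕜 (w j) (c - g)‖)
      (fun s hs => (hweak (c - g) s hs).trans (by gcongr))
    simp only [Real.rpow_one] at h1
    have h2 : ∑ j ∈ Finset.univ.filter (fun j => ¬ δ < ‖inner 𝕜 (w j) (c - g)‖),
        ‖inner 𝕜 (w j) (c - g)‖ ≤ m * δ := by
      refine (Finset.sum_le_card_nsmul _ _ δ fun j hj =>
        not_lt.1 (Finset.mem_filter.1 hj).2).trans ?_
      rw [nsmul_eq_mul, hmdef]
      gcongr
      exact Finset.card_le_univ _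
    have h3 : δ ^ r * δ ^ (1 - r) = δ := by rw [← Real.rpow_add hδ]; simp
    calc _ ≤ 2 / (1 - 2 ^ (1 - r)) * (K * δ ^ r * m) * δ ^ (1 - r) + m * δ := add_le_add h1 h2
      _ = 2 / (1 - 2 ^ (1 - r)) * K * m * (δ ^ r * δ ^ (1 - r)) + m * δ := by ring
      _ = _ := by rw [h3]; ring
  have t2 : |1 / m * ∑ j, min ‖inner 𝕜 (w j) c‖ l ^ q - 1 / m * ∑ j, min ‖inner 𝕜 (w j) g‖ l ^ q| ≤
      D * δ * (1 + 2 / (1 - 2 ^ (1 - r)) * K) := by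
    rw [← mul_sub, ← Finset.sum_sub_distrib, abs_mul, abs_of_nonneg (by positivity : 0 ≤ 1 / m)]
    calc _ ≤ 1 / m * ∑ j, D * ‖inner 𝕜 (w j) (c - g)‖ := by
          gcongr
          exact (Finset.abs_sum_le_sum_abs _ _).trans (Finset.sum_le_sum fun j _ => hLip _)
      _ ≤ 1 / m * (D * (m * (δ * (1 + 2 / (1 - 2 ^ (1 - r)) * K)))) := by
          rw [← Finset.mul_sum]; gcongr
      _ = _ := by field_simp
  -- the same two estimates for the integral
  have t4 : |∫ x, min ‖inner 𝕜 (v x) g‖ l ^ q ∂μ - ∫ x, min ‖inner 𝕜 (v x) c‖ l ^ q ∂μ| ≤ D * δ := by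
    rw [abs_sub_comm, ← integral_sub (hint c) (hint g)]
    refine abs_integral_le_integral_abs.trans ?_
    have hi : Integrable (fun x => ‖inner 𝕜 (v x) (c - g)‖) μ :=
      ((hmem (c - g)).integrable (by norm_num)).norm
    calc _ ≤ ∫ x, D * ‖inner 𝕜 (v x) (c - g)‖ ∂μ :=
          integral_mono ((hint c).sub (hint g)).abs (hi.const_mul D) fun x => hLip _
      _ = D * ∫ x, ‖inner 𝕜 (v x) (c - g)‖ ∂μ := integral_const_mul _ _
      _ ≤ D * δ := by
          gcongr
          exact integral_norm_le_of_integral_sq_le (hmem _) hδ ((hL2 _).trans (by gcongr))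
  have hqc := integrable_norm_rpow_of_le_two hq0 (by linarith) (hmem c)
  have h2c : Integrable (fun x => ‖inner 𝕜 (v x) c‖ ^ 2) μ :=
    (hmem c).integrable_norm_pow (by norm_num)
  have t5 : |∫ x, min ‖inner 𝕜 (v x) c‖ l ^ q ∂μ - ∫ x, ‖inner 𝕜 (v x) c‖ ^ q ∂μ| ≤ l ^ (q - 2) := by
    rw [abs_sub_comm, abs_of_nonneg (sub_nonneg.2 (integral_mono (hint c) hqc fun x => hminle _)),
      sub_le_iff_le_add']
    calc _ ≤ ∫ x, (min ‖inner 𝕜 (v x) c‖ l ^ q + l ^ (q - 2) * ‖inner 𝕜 (v x) c‖ ^ 2) ∂μ :=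
          integral_mono hqc ((hint c).add (h2c.const_mul _)) fun x =>
            rpow_le_min_rpow_add (by linarith) hl
      _ = ∫ x, min ‖inner 𝕜 (v x) c‖ l ^ q ∂μ + l ^ (q - 2) * ∫ x, ‖inner 𝕜 (v x) c‖ ^ 2 ∂μ := by
          rw [integral_add (hint c) (h2c.const_mul _), integral_const_mul]
      _ ≤ ∫ x, min ‖inner 𝕜 (v x) c‖ l ^ q ∂μ + l ^ (q - 2) * 1 := by
          gcongr
          simpa [hc] using hL2 c
      _ = _ := by rw [mul_one]
  -- Telescoping from the integral at `c` to the average at `c`: truncate, pass to `g`, sample,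
  -- return to `c`, remove the truncation.
  have e : ∀ a b c d e f : ℝ, f - a = (f - e) + (e - d) + (d - c) + (c - b) + (b - a) := by
    intros; ring
  rw [e _ (∫ x, min ‖inner 𝕜 (v x) c‖ l ^ q ∂μ) (∫ x, min ‖inner 𝕜 (v x) g‖ l ^ q ∂μ)
    (1 / m * ∑ j, min ‖inner 𝕜 (w j) g‖ l ^ q) (1 / m * ∑ j, min ‖inner 𝕜 (w j) c‖ l ^ q)]
  refine (abs_add_le _ _).trans ?_
  refine (add_le_add (abs_add_le _ _) le_rfl).trans ?_
  refine (add_le_add (add_le_add (abs_add_le _ _) le_rfl) le_rfl).trans ?_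
  refine (add_le_add (add_le_add (add_le_add (abs_add_le _ _) le_rfl) le_rfl) le_rfl).trans ?_
  linarith

end Discretization

/-! ### Choice of constants and of the sample. -/

section RandomSample

/-- Uniform discretization of the `q`-th moments of a random vector by `m ≥ C * N` points. -/
theorem exists_forall_abs_average_sub_integral_le {T B q r p ε : ℝ} (hT : 0 ≤ T) (hB : 0 < B)
    (hq1 : 1 ≤ q) (hqr : q < r) (hr2 : r ≤ 2) (hrp : 3 * r ≤ p) (hε : 0 < ε) :
    ∃ C : ℝ, 1 ≤ C ∧ ∀ (𝕜 E Ω : Type*) [RCLike 𝕜] [NormedAddCommGroup E] [InnerProductSpace 𝕜 E]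
      [NormedSpace ℝ E] [FiniteDimensional ℝ E] [MeasurableSpace E] [BorelSpace E]
      [MeasurableSpace Ω] (μ : Measure Ω) [IsProbabilityMeasure μ] (v : Ω → E) (N m : ℕ)
      (P : Ω → Prop), Measurable v → 1 ≤ N → C * N ≤ m → Module.finrank ℝ E ≤ 2 * N →
      (∀ᵐ x ∂μ, P x) → (∀ᵐ x ∂μ, ‖v x‖ ^ 2 ≤ T ^ 2 * N) →
      (∀ c, ∫⁻ x, ‖inner 𝕜 (v x) c‖ₑ ^ p ∂μ ≤ ENNReal.ofReal (B * ‖c‖) ^ p) →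
      (∀ c, MemLp (fun x => inner 𝕜 (v x) c) 2 μ) →
      (∀ c, ∫ x, ‖inner 𝕜 (v x) c‖ ^ 2 ∂μ ≤ ‖c‖ ^ 2) →
      ∃ ξ : Fin m → Ω, (∀ j, P (ξ j)) ∧ ∀ c, ‖c‖ = 1 →
        |1 / (m : ℝ) * ∑ j, ‖inner 𝕜 (v (ξ j)) c‖ ^ q - ∫ x, ‖inner 𝕜 (v x) c‖ ^ q ∂μ| ≤ ε := by
  have hr0 : 0 < r := by linarith
  obtain ⟨α, hα⟩ : ∃ α, α = 1 - 1 / r := ⟨_, rfl⟩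
  have hα1 : α < 1 := by rw [hα]; linarith [one_div_pos.2 hr0]
  have hα0 : 0 < α := by
    rw [hα, sub_pos, div_lt_one hr0]; linarith
  have hα2 : α ≤ 1 / 2 := by
    have := one_div_le_one_div_of_le hr0 hr2
    rw [hα]; linarith
  have hrα : r * (1 - α) = 1 := by rw [hα]; field_simp; ring
  have hpα : 3 ≤ p * (1 - α) := by
    have h1 : 0 ≤ 1 - α := by linarith
    nlinarith [mul_le_mul_of_nonneg_right hrp h1]
  obtain ⟨M, hM⟩ : ∃ M, M = T + 16 * (30 * B) / (1 - 4 ^ (-α)) := ⟨_, rfl⟩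
  have hM0 : 0 ≤ M := by
    have : (4 : ℝ) ^ (-α) < 1 := Real.rpow_lt_one_of_one_lt_of_neg (by norm_num) (by linarith)
    have : 0 ≤ 16 * (30 * B) / (1 - (4 : ℝ) ^ (-α)) := div_nonneg (by positivity) (by linarith)
    rw [hM]; positivity
  obtain ⟨K, hK⟩ : ∃ K, K = 4 * (2 * M) ^ r := ⟨_, rfl⟩
  have hK0 : 0 ≤ K := by rw [hK]; positivity
  -- The error has four quarters: `l` settles the tails of the average and of the integral, `δ` the
  -- passage to the net, and `κ` the Hoeffding exponent for deviation `ε / 4`.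
  obtain ⟨l, hl0, hl1, hl2⟩ : ∃ l : ℝ, 0 < l ∧
      2 ^ q / (1 - 2 ^ (q - r)) * K * l ^ (q - r) < ε / 4 ∧ l ^ (q - 2) < ε / 4 := by
    have h1 := (tendsto_rpow_neg_atTop (sub_pos.2 hqr)).const_mul
      (2 ^ q / (1 - 2 ^ (q - r)) * K)
    have h2 := tendsto_rpow_neg_atTop (y := 2 - q) (by linarith)
    rw [mul_zero] at h1
    simp only [neg_sub] at h1 h2
    exact ((Filter.eventually_gt_atTop 0).and ((h1.eventually_lt_const (by positivity)).and
      (h2.eventually_lt_const (by positivity)))).exists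
  obtain ⟨A, hA⟩ : ∃ A, A = q * l ^ (q - 1) * (2 + 2 / (1 - 2 ^ (1 - r)) * K) := ⟨_, rfl⟩
  have hA0 : 0 < A := by
    have : (2 : ℝ) ^ (1 - r) < 1 := Real.rpow_lt_one_of_one_lt_of_neg (by norm_num) (by linarith)
    have : 0 ≤ 2 / (1 - (2 : ℝ) ^ (1 - r)) * K :=
      mul_nonneg (div_nonneg (by norm_num) (by linarith)) hK0
    rw [hA]; positivity
  obtain ⟨δ, hδ⟩ : ∃ δ, δ = ε / 4 / A := ⟨_, rfl⟩
  have hδ0 : 0 < δ := by rw [hδ]; positivity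
  have hδA : q * l ^ (q - 1) * δ * (2 + 2 / (1 - 2 ^ (1 - r)) * K) = ε / 4 := by
    calc _ = A * δ := by rw [hA]; ring
      _ = _ := by rw [hδ]; field_simp
  obtain ⟨κ, hκ⟩ : ∃ κ, κ = 2 * (ε / 4) ^ 2 / (l ^ q) ^ 2 := ⟨_, rfl⟩
  have hκ0 : 0 < κ := by rw [hκ]; positivity
  obtain ⟨G, hG⟩ : ∃ G, G = Real.log (1 + 2 / δ) := ⟨_, rfl⟩
  have hδ1 : 1 ≤ 1 + 2 / δ := by
    have : 0 < 2 / δ := by positivity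
    linarith
  -- The real dimension is at most `2N`, so the net has at most `exp (2GN)` points; the extra `2N`
  -- in the exponent leaves failure probability `2 exp (-2N) ≤ 1 / 3`. The `1` ensures `N ≤ m`, so
  -- that `‖v‖² ≤ T² m`.
  refine ⟨max 1 ((2 * G + 2) / κ), le_max_left _ _, ?_⟩
  intro 𝕜 E Ω _ _ _ _ _ _ _ _ μ _ v N m P hv hN hCm hdim hP hvT hmom hmem hL2
  have hN' : (1 : ℝ) ≤ N := by exact_mod_cast hN
  have hNm : (N : ℝ) ≤ m := le_trans (le_mul_of_one_le_left (by linarith) (le_max_left _ _)) hCm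
  have hm0 : (0 : ℝ) < m := by linarith
  have hm0' : 0 < m := by exact_mod_cast hm0
  have : Nonempty (Fin m) := ⟨⟨0, hm0'⟩⟩
  have : ProperSpace E := FiniteDimensional.proper ℝ E
  have hκm : (2 * G + 2) * N ≤ κ * m := by
    have : (2 * G + 2) / κ * N ≤ m :=
      le_trans (mul_le_mul_of_nonneg_right (le_max_right _ _) (by linarith)) hCm
    rw [div_mul_eq_mul_div, div_le_iff₀ hκ0] at this
    linarith
  obtain ⟨net, hnet1, hnetcard, hnet⟩ := exists_net_unitBall E hδ0
  have hg : ∀ g : E, Measurable fun x => min ‖inner 𝕜 (v x) g‖ l ^ q := fun g =>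
    (((hv.inner_const).norm).min measurable_const).pow_const q
  have hg' : ∀ (g : E) (x : Ω), min ‖inner 𝕜 (v x) g‖ l ^ q ∈ Set.Icc 0 (l ^ q) := fun g x =>
    have h0 : 0 ≤ min ‖inner 𝕜 (v x) g‖ l := le_min (norm_nonneg _) hl0.le
    ⟨Real.rpow_nonneg h0 q, Real.rpow_le_rpow h0 (min_le_right _ _) (by linarith)⟩
  set π := Measure.pi (fun _ : Fin m => μ) with hπ
  set bad₁ := {ω : Fin m → Ω | ¬ SparselyCorrelated 𝕜 (fun j => v (ω j)) α (30 * B) m} with hbad₁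
  set bad₂ := ⋃ g ∈ net, {ω : Fin m → Ω | ε / 4 ≤ |1 / (m : ℝ) * ∑ j,
    min ‖inner 𝕜 (v (ω j)) g‖ l ^ q - ∫ x, min ‖inner 𝕜 (v x) g‖ l ^ q ∂μ|} with hbad₂
  set bad₃ := {ω : Fin m → Ω | ¬ ∀ j, P (ω j) ∧ ‖v (ω j)‖ ^ 2 ≤ T ^ 2 * N} with hbad₃
  have b1 : π bad₁ ≤ ENNReal.ofReal (1 / 3) := by
    have := measure_not_sparselyCorrelated_le (𝕜 := 𝕜) (μ := μ) (ι := Fin m) hv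
      (by linarith : 1 ≤ p) hB hpα hmom
    simpa using this
  have b2 : π bad₂ ≤ ENNReal.ofReal (1 / 3) := by
    have hexp : (net.card : ℝ) * (2 * Real.exp (-(κ * m))) ≤ 1 / 3 := by
      have h1 : (net.card : ℝ) ≤ Real.exp (2 * G * N) := by
        refine hnetcard.trans ((pow_le_pow_right₀ hδ1 hdim).trans_eq ?_)
        rw [hG, ← Real.exp_log (by linarith : 0 < 1 + 2 / δ), ← Real.exp_nat_mul, Real.log_exp]
        congr 1; push_cast; ring
      have h2 : Real.exp (-(κ * m)) ≤ Real.exp (-((2 * G + 2) * N)) :=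
        Real.exp_le_exp.2 (by linarith)
      calc _ ≤ Real.exp (2 * G * N) * (2 * Real.exp (-((2 * G + 2) * N))) := by gcongr
        _ = 2 * Real.exp (-(2 * N)) := by
            rw [mul_left_comm, ← Real.exp_add]; congr 2; ring
        _ ≤ 2 * Real.exp (-2) := by gcongr; linarith
        _ ≤ 1 / 3 := by
            have h3 := Real.exp_one_gt_d9
            have h4 : Real.exp 2 = Real.exp 1 * Real.exp 1 := by rw [← Real.exp_add]; norm_num
            have h5 : 6 ≤ Real.exp 2 := by rw [h4]; nlinarith
            rw [Real.exp_neg, ← div_eq_mul_inv, div_le_div_iff₀ (by positivity) (by norm_num)]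
            linarith
    refine (measure_biUnion_finset_le _ _).trans ?_
    calc _ ≤ ∑ _g ∈ net, ENNReal.ofReal (2 * Real.exp (-(κ * m))) := by
          refine Finset.sum_le_sum fun g _ => ?_
          have := measure_pi_le_abs_average_sub_le_exp (ι := Fin m) (μ := μ) (hg g) (hg' g)
            (η := ε / 4) (by positivity)
          rw [Fintype.card_fin, Measure.real_def] at this
          refine (ENNReal.le_ofReal_iff_toReal_le (measure_ne_top _ _) (by positivity)).2
            (this.trans_eq ?_)
          rw [hκ]; congr 3; ring
      _ = ENNReal.ofReal (net.card * (2 * Real.exp (-(κ * m)))) := by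
          rw [Finset.sum_const, nsmul_eq_mul, ENNReal.ofReal_mul (Nat.cast_nonneg net.card),
            ENNReal.ofReal_natCast]
      _ ≤ _ := ENNReal.ofReal_le_ofReal hexp
  have b3 : π bad₃ = 0 := by
    have : ∀ᵐ ω ∂π, ∀ j, P (ω j) ∧ ‖v (ω j)‖ ^ 2 ≤ T ^ 2 * N := by
      rw [MeasureTheory.ae_all_iff]
      intro j
      exact (Measure.quasiMeasurePreserving_eval (fun _ : Fin m => μ) j).ae (hP.and hvT)
    exact this
  obtain ⟨ω, hω⟩ : ∃ ω, ω ∉ (bad₁ ∪ bad₂) ∪ bad₃ := by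
    by_contra! hcon
    have h1 : π ((bad₁ ∪ bad₂) ∪ bad₃) = 1 := by
      rw [Set.eq_univ_of_forall hcon]; exact measure_univ
    have h2 : π ((bad₁ ∪ bad₂) ∪ bad₃) ≤ ENNReal.ofReal (1 / 3) + ENNReal.ofReal (1 / 3) + 0 :=
      (measure_union_le _ _).trans
        (add_le_add ((measure_union_le _ _).trans (add_le_add b1 b2)) b3.le)
    rw [h1, add_zero, ← ENNReal.ofReal_add (by norm_num) (by norm_num), ← ENNReal.ofReal_one,
      ENNReal.ofReal_le_ofReal_iff (by norm_num)] at h2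
    norm_num at h2
  simp only [Set.mem_union, not_or] at hω
  obtain ⟨⟨hω1, hω2⟩, hω3⟩ := hω
  have hω1' : SparselyCorrelated 𝕜 (fun j => v (ω j)) α (30 * B) m := not_not.1 hω1
  have hω3' : ∀ j, P (ω j) ∧ ‖v (ω j)‖ ^ 2 ≤ T ^ 2 * N := not_not.1 hω3
  have hsum := hω1'.norm_sum_le hα0 hα2 (by positivity) hT (Fintype.card_fin m)
    fun j => (hω3' j).2.trans (by gcongr)
  rw [← hM] at hsum
  have hweak : ∀ (c : E) (s : ℝ), 0 < s →
      ((Finset.univ.filter fun j => s < ‖inner 𝕜 (v (ω j)) c‖).card : ℝ) ≤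
        K * ‖c‖ ^ r * Fintype.card (Fin m) * s ^ (-r) := by
    intro c s hs
    refine (card_filter_lt_norm_inner_le hα1 hrα hM0 hsum c hs).trans_eq ?_
    rw [hK, Real.mul_rpow (by positivity) (norm_nonneg _), Fintype.card_fin]; ring
  refine ⟨ω, fun j => (hω3' j).1, fun c hc => ?_⟩
  obtain ⟨g, hgnet, hcg⟩ := hnet c hc.le
  have hgood : |1 / (m : ℝ) * ∑ j, min ‖inner 𝕜 (v (ω j)) g‖ l ^ q -
      ∫ x, min ‖inner 𝕜 (v x) g‖ l ^ q ∂μ| ≤ ε / 4 := by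
    by_contra! hcon
    exact hω2 (Set.mem_biUnion hgnet hcon.le)
  have := abs_average_sub_integral_le (𝕜 := 𝕜) (μ := μ) (w := fun j => v (ω j)) hq1 hqr hr2 hK0
    hl0 hδ0 hweak hmem hL2 hc hcg (η := ε / 4) (by simpa using hgood)
  rw [Fintype.card_fin, hδA] at this
  linarith

end RandomSample

/-! ### Euclidean coordinates on the function space. -/

section Coordinates

variable {Ω 𝕜 : Type*} [MeasurableSpace Ω] [RCLike 𝕜] {μ : Measure Ω}

/-- A finite-dimensional space of functions in `L₂` has coordinates in which the `L₂` seminorm is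
Euclidean and almost every evaluation is represented by a vector. -/
theorem exists_euclidean_coordinates (X : Submodule 𝕜 (Ω → 𝕜)) [FiniteDimensional 𝕜 X]
    (h2 : ∀ f ∈ X, MemLp f 2 μ) :
    ∃ (n : ℕ) (v : Ω → EuclideanSpace 𝕜 (Fin n)) (Φ : X →ₗ[𝕜] EuclideanSpace 𝕜 (Fin n)),
      n ≤ Module.finrank 𝕜 X ∧ Measurable v ∧ Function.Surjective Φ ∧
      (∀ f : X, eLpNorm (f : Ω → 𝕜) 2 μ = ‖Φ f‖ₑ) ∧
      ∀ᵐ x ∂μ, ∀ f : X, (f : Ω → 𝕜) x = inner 𝕜 (v x) (Φ f) := by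
  let L : X →ₗ[𝕜] Lp 𝕜 2 μ :=
    { toFun := fun f => (h2 f f.2).toLp f
      map_add' := fun f g => MemLp.toLp_add (h2 f f.2) (h2 g g.2)
      map_smul' := fun a f => MemLp.toLp_const_smul a (h2 f f.2) }
  let b := stdOrthonormalBasis 𝕜 (LinearMap.range L)
  have hu : ∀ i, ∃ f : X, L f = b i := fun i => (b i).2
  choose u hu using hu
  have hus : ∀ i, AEStronglyMeasurable (u i : Ω → 𝕜) μ := fun i => (h2 _ (u i).2).1
  let v : Ω → EuclideanSpace 𝕜 (Fin (Module.finrank 𝕜 (LinearMap.range L))) := fun x =>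
    WithLp.toLp 2 fun i => (starRingEnd 𝕜) ((hus i).mk _ x)
  let Φ : X →ₗ[𝕜] EuclideanSpace 𝕜 (Fin (Module.finrank 𝕜 (LinearMap.range L))) :=
    b.repr.toLinearEquiv.toLinearMap ∘ₗ L.rangeRestrict
  have hΦ : ∀ f, Φ f = b.repr (L.rangeRestrict f) := fun f => rfl
  refine ⟨_, v, Φ, LinearMap.finrank_range_le L, ?_, ?_, ?_, ?_⟩
  · refine (WithLp.measurable_toLp 2 _).comp (measurable_pi_lambda _ fun i => ?_)
    exact RCLike.continuous_conj.measurable.comp (hus i).stronglyMeasurable_mk.measurable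
  · exact b.repr.surjective.comp (LinearMap.surjective_rangeRestrict L)
  · intro f
    rw [hΦ, LinearIsometryEquiv.enorm_map]
    change _ = ‖L f‖ₑ
    exact (Lp.enorm_toLp (h2 f f.2)).symm
  · have hL0 : ∀ f g : X, L f = L g → (f : Ω → 𝕜) =ᵐ[μ] g := fun f g h =>
      (MemLp.toLp_eq_toLp_iff (h2 f f.2) (h2 g g.2)).1 h
    have hsingle : ∀ f : X, ∀ᵐ x ∂μ, (f : Ω → 𝕜) x = inner 𝕜 (v x) (Φ f) := by
      intro f
      have h1 : L f = L (∑ i, (Φ f) i • u i) := by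
        have := congrArg (LinearMap.range L).subtype (b.sum_repr (L.rangeRestrict f))
        rw [map_sum] at this
        simp only [map_smul] at this
        rw [map_sum]
        simp only [map_smul, hu]
        exact this.symm
      filter_upwards [hL0 _ _ h1, ae_all_iff.2 fun i => (hus i).ae_eq_mk] with x hx hx'
      rw [hx]
      simp only [v, PiLp.inner_apply, RCLike.inner_apply, RCLike.conj_conj]
      rw [Submodule.coe_sum, Finset.sum_apply]
      exact Finset.sum_congr rfl fun i _ => by simp [hx' i]
    -- Each `f` has its own null set. Representing a finite basis suffices, so one null set serves
    -- all `f` at once.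
    let β := Module.finBasis 𝕜 X
    filter_upwards [ae_all_iff.2 fun i => hsingle (β i)] with x hx f
    let e₁ : X →ₗ[𝕜] 𝕜 := (LinearMap.proj x : (Ω → 𝕜) →ₗ[𝕜] 𝕜) ∘ₗ X.subtype
    let e₂ : X →ₗ[𝕜] 𝕜 := (innerₛₗ 𝕜 (v x)) ∘ₗ Φ
    have : e₁ = e₂ := β.ext hx
    exact LinearMap.congr_fun this f

end Coordinates

/-! ### Translation of the norm hypotheses and the final reduction. -/

section Reduction

variable {Ω 𝕜 : Type*} [MeasurableSpace Ω] [RCLike 𝕜] {μ : Measure Ω}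

theorem integral_norm_rpow_eq_toReal_eLpNorm_rpow {f : Ω → 𝕜} {q : ℝ} (hq : 0 < q)
    (hf : MemLp f (ENNReal.ofReal q) μ) :
    ∫ x, ‖f x‖ ^ q ∂μ = (eLpNorm f (ENNReal.ofReal q) μ).toReal ^ q := by
  have h0 : 0 ≤ ∫ x, ‖f x‖ ^ q ∂μ := integral_nonneg fun x => by positivity
  rw [hf.eLpNorm_eq_integral_rpow_norm (by simpa using hq) ENNReal.ofReal_ne_top,
    ENNReal.toReal_ofReal hq.le, ENNReal.toReal_ofReal (by positivity), ← Real.rpow_mul h0,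
    inv_mul_cancel₀ hq.ne', Real.rpow_one]

theorem lintegral_enorm_rpow_eq_eLpNorm_rpow {f : Ω → 𝕜} {p : ℝ} (hp : 0 < p) :
    ∫⁻ x, ‖f x‖ₑ ^ p ∂μ = eLpNorm f (ENNReal.ofReal p) μ ^ p := by
  rw [eLpNorm_eq_lintegral_rpow_enorm_toReal (by simpa using hp) ENNReal.ofReal_ne_top,
    ENNReal.toReal_ofReal hp.le, ← ENNReal.rpow_mul, one_div, inv_mul_cancel₀ hp.ne',
    ENNReal.rpow_one]

/-- The exceptional null set depends on `c`. A countable dense set of `c` and continuity remove this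
dependence, after which `c = v x` may be taken. -/
theorem norm_sq_le_of_forall_eLpNorm_top_le {E : Type*} [NormedAddCommGroup E]
    [InnerProductSpace 𝕜 E] [TopologicalSpace.SeparableSpace E] {v : Ω → E} {a : ℝ}
    (h : ∀ c, eLpNorm (fun x => inner 𝕜 (v x) c) ∞ μ ≤ ENNReal.ofReal a * ‖c‖ₑ) :
    ∀ᵐ x ∂μ, ‖v x‖ ^ 2 ≤ a ^ 2 := by
  have h1 : ∀ c : E, ∀ᵐ x ∂μ, ‖inner 𝕜 (v x) c‖ ≤ max a 0 * ‖c‖ := by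
    intro c
    filter_upwards [ae_le_eLpNormEssSup (f := fun x => inner 𝕜 (v x) c) (μ := μ)] with x hx
    rw [← eLpNorm_exponent_top] at hx
    have := hx.trans (h c)
    rw [← ofReal_norm, ← ofReal_norm, ← ENNReal.ofReal_mul' (norm_nonneg _),
      ENNReal.ofReal_le_ofReal_iff'] at this
    rcases this with this | this
    · exact this.trans (by gcongr; exact le_max_left _ _)
    · exact this.trans (by positivity)
  filter_upwards [ae_all_iff.2 fun n => h1 (TopologicalSpace.denseSeq E n)] with x hx
  have h2 : ∀ c : E, ‖inner 𝕜 (v x) c‖ ≤ max a 0 * ‖c‖ := by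
    intro c
    refine (TopologicalSpace.denseRange_denseSeq E).induction_on
      (p := fun c => ‖inner 𝕜 (v x) c‖ ≤ max a 0 * ‖c‖) c ?_ hx
    exact isClosed_le (by fun_prop) (by fun_prop)
  have h3 := h2 (v x)
  rw [inner_self_eq_norm_sq_to_K, norm_pow, RCLike.norm_ofReal, abs_norm] at h3
  have h4 : ‖v x‖ ≤ max a 0 := by
    by_contra! hcon
    have : 0 ≤ max a 0 := le_max_right _ _
    nlinarith
  calc ‖v x‖ ^ 2 ≤ (max a 0) ^ 2 := by gcongr
    _ ≤ a ^ 2 := by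
      rcases max_cases a 0 with ⟨h, _⟩ | ⟨h, _⟩ <;> rw [h]
      simpa using sq_nonneg a

end Reduction

theorem mainTheorem3 (t B q p ε : ℝ) (hB : 0 < B) (hq₁ : 1 ≤ q) (hq₂ : q < 2)
    (hpq : 4 * q ≤ p) (hp : 4 < p) (hε₀ : 0 < ε) (hε₁ : ε < 1) :
    ∃ C : ℝ, 0 < C ∧
      ∀ (𝕜 : Type) [RCLike 𝕜] (Ω : Type*) [MeasurableSpace Ω] (μ : Measure Ω)
        [IsProbabilityMeasure μ] (N : ℕ) (X : Submodule 𝕜 (Ω → 𝕜)),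
        IsSubspaceOfLq μ q N X →
        NikolskiiTwoInfty μ t N X →
        MomentComparison μ p q B X →
        ∀ m : ℕ, C * (N : ℝ) ≤ (m : ℝ) → MarcinkiewiczEps μ X m q ε := by
  have hq0 : 0 < q := by linarith
  -- The exponent `r = min 2 (4q/3)` exceeds `q`, is at most `2`, and satisfies `3r ≤ 4q ≤ p`.
  have hqr : q < min 2 (4 * q / 3) := lt_min hq₂ (by linarith)
  have hrp : 3 * min 2 (4 * q / 3) ≤ p := by
    have := min_le_right 2 (4 * q / 3)
    linarith
  -- On the unit sphere the integral is at least `B⁻¹ ^ q`, so this absolute error is a relative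
  -- error of at most `ε`.
  have hε' : 0 < ε * B⁻¹ ^ q := by positivity
  obtain ⟨C, hC1, hC⟩ := exists_forall_abs_average_sub_integral_le (abs_nonneg t) hB hq₁ hqr
    (min_le_left _ _) hrp hε'
  refine ⟨C, by linarith, ?_⟩
  intro 𝕜 _ Ω _ μ _ N X hX hnik hmom m hm
  have hΩ : Nonempty Ω := μ.nonempty_of_neZero
  obtain ⟨g, hg⟩ := hX.exists_span
  have hfin : FiniteDimensional 𝕜 X := by
    rw [hg]; exact FiniteDimensional.span_of_finite 𝕜 (Set.finite_range g)
  have hdimX : Module.finrank 𝕜 X ≤ N := by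
    rw [hg]; exact (finrank_range_le_card g).trans_eq (Fintype.card_fin N)
  rcases Nat.eq_zero_or_pos N with rfl | hN
  · refine ⟨fun _ => hΩ.some, fun f hf => ?_⟩
    have : f = 0 := by simpa [hg] using hf
    subst this
    simp [Real.zero_rpow hq0.ne']
  have hp2 : (2 : ℝ≥0∞) ≤ ENNReal.ofReal p := by
    rw [show (2 : ℝ≥0∞) = ENNReal.ofReal 2 by simp]
    exact ENNReal.ofReal_le_ofReal (by linarith)
  have hq2 : ENNReal.ofReal q ≤ 2 := by
    rw [show (2 : ℝ≥0∞) = ENNReal.ofReal 2 by simp]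
    exact ENNReal.ofReal_le_ofReal hq₂.le
  have hmem : ∀ f ∈ X, MemLp f 2 μ := fun f hf =>
    MemLp.mono_exponent (⟨(hX.memLp f hf).1, (hmom f hf).trans_lt
      (ENNReal.mul_lt_top ENNReal.ofReal_lt_top (hX.memLp f hf).2)⟩ : MemLp f (ENNReal.ofReal p) μ) hp2
  obtain ⟨n, v, Φ, hn, hv, hΦ, hnorm, hrep⟩ := exists_euclidean_coordinates X hmem
  have hae : ∀ f : X, (fun x => inner 𝕜 (v x) (Φ f)) =ᵐ[μ] f := fun f => by
    filter_upwards [hrep] with x hx using (hx f).symm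
  have hdim : Module.finrank ℝ (EuclideanSpace 𝕜 (Fin n)) ≤ 2 * N := by
    rw [← Module.finrank_mul_finrank ℝ 𝕜 (EuclideanSpace 𝕜 (Fin n)), finrank_euclideanSpace_fin]
    exact Nat.mul_le_mul (RCLike.finrank_le_two 𝕜) (hn.trans hdimX)
  have hmem' : ∀ c, MemLp (fun x => inner 𝕜 (v x) c) 2 μ := by
    intro c
    obtain ⟨f, rfl⟩ := hΦ c
    exact (memLp_congr_ae (hae f)).2 (hmem f f.2)
  have hlower : ∀ e, ‖e‖ = 1 → B⁻¹ ^ q ≤ ∫ x, ‖inner 𝕜 (v x) e‖ ^ q ∂μ := by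
    intro e he
    obtain ⟨f, rfl⟩ := hΦ e
    have hmq := (hmem' (Φ f)).mono_exponent hq2
    rw [integral_norm_rpow_eq_toReal_eLpNorm_rpow hq0 hmq, eLpNorm_congr_ae (hae f)]
    have h1 : 1 ≤ ENNReal.ofReal B * eLpNorm (f : Ω → 𝕜) (ENNReal.ofReal q) μ := by
      refine le_trans ?_ (hmom f f.2)
      refine le_trans ?_ (eLpNorm_le_eLpNorm_of_exponent_le hp2 (hmem f f.2).1)
      rw [hnorm, ← ofReal_norm, he, ENNReal.ofReal_one]
    have h2 := ENNReal.toReal_mono (ENNReal.mul_ne_top ENNReal.ofReal_ne_top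
      (hX.memLp f f.2).2.ne) h1
    rw [ENNReal.toReal_one, ENNReal.toReal_mul, ENNReal.toReal_ofReal hB.le] at h2
    gcongr
    rwa [inv_le_iff_one_le_mul₀' hB]
  have hvT : ∀ᵐ x ∂μ, ‖v x‖ ^ 2 ≤ |t| ^ 2 * N := by
    have := norm_sq_le_of_forall_eLpNorm_top_le (𝕜 := 𝕜) (μ := μ) (v := v) (a := t * √N) fun c => by
      obtain ⟨f, rfl⟩ := hΦ c
      rw [eLpNorm_congr_ae (hae f), ← hnorm]
      exact hnik f f.2
    simpa [mul_pow] using this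
  have hvmom : ∀ c, ∫⁻ x, ‖inner 𝕜 (v x) c‖ₑ ^ p ∂μ ≤ ENNReal.ofReal (B * ‖c‖) ^ p := by
    intro c
    obtain ⟨f, rfl⟩ := hΦ c
    rw [lintegral_enorm_rpow_eq_eLpNorm_rpow (by linarith), eLpNorm_congr_ae (hae f)]
    refine ENNReal.rpow_le_rpow ((hmom f f.2).trans ?_) (by linarith)
    rw [ENNReal.ofReal_mul hB.le, ofReal_norm, ← hnorm]
    gcongr
    exact eLpNorm_le_eLpNorm_of_exponent_le hq2 (hmem f f.2).1
  have hL2 : ∀ c, ∫ x, ‖inner 𝕜 (v x) c‖ ^ 2 ∂μ ≤ ‖c‖ ^ 2 := by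
    intro c
    obtain ⟨f, rfl⟩ := hΦ c
    have h := integral_norm_rpow_eq_toReal_eLpNorm_rpow (q := 2) (f := fun x => inner 𝕜 (v x) (Φ f))
      (μ := μ) (by norm_num) (by simpa using hmem' (Φ f))
    rw [eLpNorm_congr_ae (hae f)] at h
    simp only [ENNReal.ofReal_ofNat, hnorm, toReal_enorm, Real.rpow_ofNat] at h
    exact h.le
  -- The predicate makes the representation exact at the sample points, as needed for honest
  -- functions rather than classes.
  obtain ⟨ξ, hξ, hsample⟩ := hC 𝕜 (EuclideanSpace 𝕜 (Fin n)) Ω μ v N m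
    (fun x => ∀ f : X, (f : Ω → 𝕜) x = inner 𝕜 (v x) (Φ f)) hv hN hm hdim hrep hvT hvmom hmem' hL2
  refine ⟨ξ, fun f hf => ?_⟩
  have e1 : ∑ j, ‖f (ξ j)‖ ^ q = ∑ j, ‖inner 𝕜 (v (ξ j)) (Φ ⟨f, hf⟩)‖ ^ q :=
    Finset.sum_congr rfl fun j _ => by rw [← hξ j ⟨f, hf⟩]
  have e2 : ∫ x, ‖f x‖ ^ q ∂μ = ∫ x, ‖inner 𝕜 (v x) (Φ ⟨f, hf⟩)‖ ^ q ∂μ :=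
    integral_congr_ae (by
      filter_upwards [hrep] with x hx
      rw [← hx ⟨f, hf⟩])
  rw [e1, e2]
  generalize Φ ⟨f, hf⟩ = c
  rcases eq_or_ne c 0 with rfl | hc
  · simp [Real.zero_rpow hq0.ne']
  have hc' : 0 < ‖c‖ := norm_pos_iff.2 hc
  obtain ⟨e, he, hce⟩ : ∃ e, ‖e‖ = 1 ∧ c = ((‖c‖ : ℝ) : 𝕜) • e := by
    have h0 : ((‖c‖ : ℝ) : 𝕜) ≠ 0 := by simpa using hc
    refine ⟨((‖c‖ : ℝ) : 𝕜)⁻¹ • c, ?_, (smul_inv_smul₀ h0 c).symm⟩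
    rw [norm_smul, norm_inv, RCLike.norm_ofReal, abs_norm, inv_mul_cancel₀ hc'.ne']
  have hscale : ∀ u, ‖inner 𝕜 u c‖ ^ q = ‖c‖ ^ q * ‖inner 𝕜 u e‖ ^ q := by
    intro u
    conv_lhs => rw [hce]
    rw [inner_smul_right, norm_mul, RCLike.norm_ofReal, abs_norm,
      Real.mul_rpow (norm_nonneg _) (norm_nonneg _)]
  simp only [hscale, ← Finset.mul_sum, integral_const_mul]
  have h1 := abs_le.1 (hsample e he)
  have h2 := mul_le_mul_of_nonneg_left (hlower e he) hε₀.le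
  have h3 : 0 ≤ ‖c‖ ^ q := by positivity
  rw [mul_left_comm (1 - ε), mul_left_comm (1 / (m : ℝ)), mul_left_comm (1 + ε)]
  exact ⟨mul_le_mul_of_nonneg_left (by linarith) h3, mul_le_mul_of_nonneg_left (by linarith) h3⟩
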